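/- For $m\ge 3$ let $Q_m$ be the mirror complex of the $m$-gon: the complex of all nonempty faces of the cube $[0,1]^m$ (words in $\{0,1,*\}^m$, where $*$ marks a free coordinate) that have at most two free coordinates and for which two free coordinates, if there are two, are cyclically successive modulo $m$. **Theorem.** Let $m\ge 3$. Then $Q_m$ is a combinatorial surface (a pure $2$-dimensional complex, connected and orientable, all of whose vertex links are circles, and in which any two faces intersect in a face or not at all). It has $f_0=2^m$ vertices, $f_1=m2^{m-1}$ edges and $f_2=m2^{m-2}$ quadrilaterals, and its genus $1+\frac12(f_1-f_0-f_2)$ is $1+(m-4)2^{m-3}$. It has a geometric (polyhedral) realization in $\mathbb R^3$, that is, there is a complex of convex polytopes in $\mathbb R^3$ (points, segments and convex quadrilaterals, any two of which are disjoint or meet in a common face) whose face poset is that of $Q_m$, with dimensions preserved. Moreover, let $m\ge 4$. For $\varepsilon>0$ and $b\in\mathbb R^m$ let $D_m^\varepsilon$ be the set of all $x\in\mathbb R^m$ that satisfy, for $k=1,\dots,m$ and for both signs, the inequality $$-2x_{k-4}+7x_{k-3}-7x_{k-2}+2x_{k-1}\pm\varepsilon x_k\le b_k,\qquad x_0=x_{-1}=x_{-2}=x_{-3}=0,$$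 where the right-hand sides grow fast: all $b_k>0$ and $b_{k+1}\ge\frac6\varepsilon b_k$ for $1\le k<m$ (for example $b_k=(6/\varepsilon)^{k-1}$). Let $\pi:\mathbb R^m\to\mathbb R^4$ be the projection to the last four coordinates. Then there is $\varepsilon_0>0$, depending only on $m$, such that for all $0<\varepsilon<\varepsilon_0$ and all such $b$ the set $\pi(D_m^\varepsilon)$ is a $4$-dimensional polytope, and for every facet $F_0$ of it and every point $y$ beyond $F_0$ (violating the inequality that defines $F_0$ and strictly satisfying the inequalities that define the other facets), a realization of $Q_m$ as above can be found as a subcomplex of the Schlegel diagram $\mathcal D(\pi(D_m^\varepsilon),F_0)$. Here the Schlegel diagram consists of the images of all faces of $\pi(D_m^\varepsilon)$ other than $\pi(D_m^\varepsilon)$ and $F_0$ under central projection from $y$ to the hyperplane $\operatorname{aff}F_0$, and this hyperplane is identified with $\mathbb R^3$ by an arbitrary affine isomorphism. -/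

import Mathlib

/-! ### Convex polytopes and their faces -/

section Polytopes

variable {E : Type*} [AddCommGroup E] [Module ℝ E]

/-- A polytope: the convex hull of a finite set. -/
def IsPolytope (P : Set E) : Prop :=
  ∃ T : Set E, T.Finite ∧ P = convexHull ℝ T

/-- The dimension of the affine hull of a (nonempty) set. -/
noncomputable def affineDim (S : Set E) : ℕ :=
  Module.finrank ℝ (vectorSpan ℝ S)

/-- The linear inequality `a x ≤ c` is valid on `P`. -/
def IsValidOn (P : Set E) (a : Module.Dual ℝ E) (c : ℝ) : Prop :=
  ∀ x ∈ P, a x ≤ c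

/-- The subset of `P` on which `a x = c`. It is a face of `P` when `a x ≤ c` is valid on `P`. -/
def faceOf (P : Set E) (a : Module.Dual ℝ E) (c : ℝ) : Set E :=
  {x ∈ P | a x = c}

/-- Faces of a polytope `P`, including `∅` and `P` itself. -/
def IsFace (P G : Set E) : Prop :=
  ∃ (a : Module.Dual ℝ E) (c : ℝ), IsValidOn P a c ∧ G = faceOf P a c

/-- Facets: nonempty faces of dimension one less than the polytope. -/
def IsFacet (P F : Set E) : Prop :=
  IsFace P F ∧ F.Nonempty ∧ affineDim F + 1 = affineDim P

/-- The point `y` is beyond the facet `F` of the full-dimensional polytope `P`: it violates the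
inequality that defines `F`, and strictly satisfies those that define the other facets. -/
def IsBeyond (P F : Set E) (y : E) : Prop :=
  (∀ (a : Module.Dual ℝ E) (c : ℝ), IsValidOn P a c → F = faceOf P a c → c < a y) ∧
  ∀ G : Set E, IsFacet P G → G ≠ F →
    ∀ (a : Module.Dual ℝ E) (c : ℝ), IsValidOn P a c → G = faceOf P a c → a y < c

/-- Central projection from `y` to the hyperplane `a x = c`: the point where the line through `y`
and `x` meets the hyperplane. -/
noncomputable def schlegelProj (a : Module.Dual ℝ E) (c : ℝ) (y x : E) : E :=
  y + ((c - a y) / (a x - a y)) • (x - y)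

/-- The Schlegel diagram of `P` based at the facet `faceOf P a c`, seen from the point `y` beyond
this facet: the images of all faces of `P` other than `P` itself and this facet. -/
def schlegelDiagram (P : Set E) (a : Module.Dual ℝ E) (c : ℝ) (y : E) : Set (Set E) :=
  {S | ∃ G : Set E, IsFace P G ∧ G ≠ P ∧ G ≠ faceOf P a c ∧ S = schlegelProj a c y '' G}

end Polytopes

/-! ### Subcomplexes of the cube and mirror complexes -/

/-- The nonempty faces of `[0,1]^m`, as words in `{0,1,*}^m`: the value `none` stands for `*`
(the coordinate is free), `some false` for `0` and `some true` for `1`. -/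
abbrev CubeFace (m : ℕ) : Type := Fin m → Option Bool

/-- The set of free coordinates. -/
def CubeFace.free {m : ℕ} (s : CubeFace m) : Finset (Fin m) :=
  Finset.univ.filter fun i => s i = none

/-- The dimension of a face of the cube. -/
def CubeFace.dim {m : ℕ} (s : CubeFace m) : ℕ := s.free.card

/-- Inclusion of faces of the cube. -/
def CubeFace.IsSubface {m : ℕ} (s t : CubeFace m) : Prop :=
  ∀ i, t i = none ∨ s i = t i

/-- The mirror complex of a simplicial complex `K` (a family of finite sets containing `∅`) on the
vertex set `Fin m`: all faces of the `m`-cube whose set of free coordinates belongs to `K`. -/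
def mirrorComplex {m : ℕ} (K : Set (Finset (Fin m))) : Set (CubeFace m) :=
  {s | s.free ∈ K}

/-- The boundary complex of an `m`-gon: the empty set, the `m` vertices, and the `m` edges, which
join the cyclically successive vertices. -/
def polygonComplex (m : ℕ) : Set (Finset (Fin m)) :=
  {σ | σ.card ≤ 2 ∧ ∀ i ∈ σ, ∀ j ∈ σ, i ≠ j → (SimpleGraph.cycleGraph m).Adj i j}

/-- The quad-surface `Q_m`: all faces of the `m`-cube for which at most two coordinates are free,
and for which two free coordinates are cyclically successive. -/
def quadSurface (m : ℕ) : Set (CubeFace m) := mirrorComplex (polygonComplex m)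

/-- The number of `k`-dimensional faces. -/
noncomputable def numFaces {m : ℕ} (Q : Set (CubeFace m)) (k : ℕ) : ℕ :=
  Set.ncard {s : CubeFace m | s ∈ Q ∧ s.dim = k}

/-- The genus `1 + (f₁ - f₀ - f₂) / 2`, that is, `1 - χ / 2`, of a combinatorial surface. -/
noncomputable def genus {m : ℕ} (Q : Set (CubeFace m)) : ℚ :=
  1 + ((numFaces Q 1 : ℚ) - numFaces Q 0 - numFaces Q 2) / 2

/-! ### Combinatorial surfaces -/

/-- The graph (1-skeleton) of a complex. -/
def skeletonGraph {m : ℕ} (Q : Set (CubeFace m)) :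
    SimpleGraph {v : CubeFace m // v ∈ Q ∧ v.dim = 0} where
  Adj v w := v ≠ w ∧ ∃ e ∈ Q, e.dim = 1 ∧ v.1.IsSubface e ∧ w.1.IsSubface e
  symm := ⟨fun _ _ ⟨hne, e, he, hd, hv, hw⟩ => ⟨hne.symm, e, he, hd, hw, hv⟩⟩
  loopless := ⟨fun _ h => h.1 rfl⟩

/-- The link of a vertex `v`: its nodes are the edges at `v`, and two of them are adjacent when
they lie in a common 2-face. -/
def linkGraph {m : ℕ} (Q : Set (CubeFace m)) (v : CubeFace m) :
    SimpleGraph {e : CubeFace m // e ∈ Q ∧ e.dim = 1 ∧ v.IsSubface e} where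
  Adj e e' := e ≠ e' ∧ ∃ f ∈ Q, f.dim = 2 ∧ e.1.IsSubface f ∧ e'.1.IsSubface f
  symm := ⟨fun _ _ ⟨hne, f, hf, hd, h, h'⟩ => ⟨hne.symm, f, hf, hd, h', h⟩⟩
  loopless := ⟨fun _ h => h.1 rfl⟩

/-- Orientability: the edges of each 2-face `f` can be directed, by choosing a head `h f e` of each
edge `e` of `f`, so that the boundary of `f` becomes a directed cycle (different edges of `f` have
different heads) and the two 2-faces at an edge direct it in opposite ways. -/
def IsOrientable {m : ℕ} (Q : Set (CubeFace m)) : Prop :=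
  ∃ h : CubeFace m → CubeFace m → CubeFace m,
    (∀ f ∈ Q, f.dim = 2 → ∀ e ∈ Q, e.dim = 1 → e.IsSubface f →
      (h f e).dim = 0 ∧ (h f e).IsSubface e) ∧
    (∀ f ∈ Q, f.dim = 2 → ∀ e ∈ Q, e.dim = 1 → e.IsSubface f →
      ∀ e' ∈ Q, e'.dim = 1 → e'.IsSubface f → e ≠ e' → h f e ≠ h f e') ∧
    (∀ f ∈ Q, f.dim = 2 → ∀ f' ∈ Q, f'.dim = 2 → f ≠ f' →
      ∀ e ∈ Q, e.dim = 1 → e.IsSubface f → e.IsSubface f' → h f e ≠ h f' e)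

/-- A complex of faces of a cube is a combinatorial surface: a pure 2-dimensional complex in which
every vertex link is a circle, connected, orientable, and such that the intersection of any two
faces is empty or a face. -/
structure IsCombinatorialSurface {m : ℕ} (Q : Set (CubeFace m)) : Prop where
  subface_mem : ∀ s ∈ Q, ∀ t : CubeFace m, t.IsSubface s → t ∈ Q
  pure : ∀ s ∈ Q, s.dim ≤ 2 ∧ ∃ f ∈ Q, f.dim = 2 ∧ s.IsSubface f
  link : ∀ v ∈ Q, v.dim = 0 →
    ∃ n, 3 ≤ n ∧ Nonempty (linkGraph Q v ≃g SimpleGraph.cycleGraph n)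
  connected : (skeletonGraph Q).Connected
  orientable : IsOrientable Q
  inter : ∀ s ∈ Q, ∀ t ∈ Q,
    (∃ r ∈ Q, ∀ u ∈ Q, (u.IsSubface s ∧ u.IsSubface t) ↔ u.IsSubface r) ∨
      ¬ ∃ u ∈ Q, u.IsSubface s ∧ u.IsSubface t

/-- The family `R` of subsets of `E` is a geometric (polyhedral) realization of the complex `Q`: the
sets `R s`, for `s ∈ Q`, are convex polytopes of dimension `s.dim`, the nonempty faces of the
polytope `R s` are the sets `R t` for the subfaces `t` of `s`, inclusions are those of `Q`, and any
two of the polytopes are disjoint or meet in a common face. -/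
structure IsGeometricRealization {m : ℕ} {E : Type*} [AddCommGroup E] [Module ℝ E]
    (Q : Set (CubeFace m)) (R : CubeFace m → Set E) : Prop where
  polytope : ∀ s ∈ Q, IsPolytope (R s)
  nonempty : ∀ s ∈ Q, (R s).Nonempty
  dim_eq : ∀ s ∈ Q, affineDim (R s) = s.dim
  faces : ∀ s ∈ Q, ∀ G : Set E,
    (G.Nonempty ∧ IsFace (R s) G) ↔ ∃ t ∈ Q, t.IsSubface s ∧ R t = G
  subset_iff : ∀ s ∈ Q, ∀ t ∈ Q, R t ⊆ R s ↔ t.IsSubface s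
  inter : ∀ s ∈ Q, ∀ t ∈ Q, (R s ∩ R t).Nonempty →
    ∃ r ∈ Q, r.IsSubface s ∧ r.IsSubface t ∧ R s ∩ R t = R r

/-! ### The deformed cube -/

/-- The lower triangular `m × m` band matrix with `δ` on the diagonal and `2, -7, 7, -2` on the
first four subdiagonals. -/
def deformedMatrix (m : ℕ) (δ : ℝ) : Matrix (Fin m) (Fin m) ℝ :=
  Matrix.of fun k j =>
    if (k : ℕ) = j then δ
    else if (k : ℕ) = j + 1 then 2
    else if (k : ℕ) = j + 2 then -7
    else if (k : ℕ) = j + 3 then 7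
    else if (k : ℕ) = j + 4 then -2
    else 0

/-- The deformed cube `D_m^ε` with right-hand side `b`, given by `2m` linear inequalities. -/
def deformedCube (m : ℕ) (ε : ℝ) (b : Fin m → ℝ) : Set (Fin m → ℝ) :=
  {x | ∀ k : Fin m,
    (deformedMatrix m ε).mulVec x k ≤ b k ∧ (deformedMatrix m (-ε)).mulVec x k ≤ b k}

/-- The right-hand sides grow fast enough: they are positive, and each is at least `6 / ε` times the
preceding one. The standard example is `b k = (6 / ε) ^ k` for `k = 0, …, m - 1`. -/
def GrowsFast {m : ℕ} (ε : ℝ) (b : Fin m → ℝ) : Prop :=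
  (∀ k, 0 < b k) ∧ ∀ k l : Fin m, (l : ℕ) = k + 1 → 6 / ε * b k ≤ b l

/-- The projection `ℝ^m → ℝ^4` to the last four coordinates. -/
def lastFour {m : ℕ} (hm : 4 ≤ m) : (Fin m → ℝ) →ₗ[ℝ] (Fin 4 → ℝ) :=
  LinearMap.funLeft ℝ ℝ fun i : Fin 4 => (⟨m - 4 + i, by omega⟩ : Fin m)

/-- The projection of the deformed cube to the last four coordinates. -/
def projectedCube {m : ℕ} (hm : 4 ≤ m) (ε : ℝ) (b : Fin m → ℝ) : Set (Fin 4 → ℝ) :=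
  lastFour hm '' deformedCube m ε b

/-!
Combinatorially, `Q_m` is a surface because the faces of an `m`-gon are the subsets of the pairs
`{i, i + 1}`: the link of a vertex of the cube is the `m`-gon itself. An orientation comes from the
parity of the fixed coordinates of an edge, with a twist between the two squares at the edge
(`quadHead`).

For the realization, the deformed cube is a combinatorial cube: as the right-hand sides grow fast,
each pair of inequalities leaves a nondegenerate interval for its coordinate
(`GrowsFast.abs_bandRow_lt`). Hence its faces correspond to the words in `{0, 1, *}^m`
(`deformedFace`). They are polytopes by the Krein-Milman theorem, and the convex extreme subsets of
a face are again faces (`exists_eq_deformedFace_of_isExtreme`).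

A face is strictly preserved by the projection to the last four coordinates if the normal vectors of
the facets that contain it, truncated to the first `m - 4` coordinates, span and have a positive
linear dependence (`isStrictlyPreserved_of_weights`). Both properties survive small perturbations
(`eventually_exists_pos_vecMul_eq_zero`), so they have to be checked for `ε = 0` only. There the
dependences are the sequences `p (2 ^ k) / 2 ^ k` for quadratic polynomials `p`, since
`2 - 7 t + 7 t² - 2 t³` has the roots `1`, `2`, `1 / 2`; and a quadratic polynomial may vanish on
any face of the `m`-gon and be positive at all other vertices (`exists_band_dependence`). So all
faces in `Q_m` are strictly preserved.

A face of codimension two of a polytope lies in two facets, so in one other than the facet at which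
the Schlegel diagram is based (`exists_isFacet_ne`); the viewpoint lies strictly on the inner side
of that facet. This makes the central projection injective on the union of the faces in `Q_m`, and
allows to tilt the functional that exposes a subface until its hyperplane passes through the
viewpoint, so that it exposes the image of the subface as well
(`isGeometricRealization_schlegel`). As central projections preserve segments, the images have
no other faces (`isGeometricRealization_image`).

For `m ≥ 4` a suitable viewpoint exists just above a point of a facet that lies in none of the
2-dimensional faces (`exists_viewpoint`), and for `m = 3` the deformed cube itself is the
realization.
-/

/-! ### The combinatorics of the quad-surface -/

namespace CubeFace

variable {m : ℕ}

theorem mem_free {s : CubeFace m} {i : Fin m} : i ∈ s.free ↔ s i = none := by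
  simp [free]

theorem IsSubface.refl (s : CubeFace m) : s.IsSubface s := fun _ => Or.inr rfl

theorem IsSubface.eq_none {t s : CubeFace m} (h : t.IsSubface s) {i : Fin m} (hi : t i = none) :
    s i = none := by
  rcases h i with h | h
  · exact h
  · rw [← h, hi]

theorem IsSubface.eq_of_ne_none {t s : CubeFace m} (h : t.IsSubface s) {i : Fin m}
    (hi : s i ≠ none) : t i = s i :=
  (h i).resolve_left hi

theorem IsSubface.free_subset {t s : CubeFace m} (h : t.IsSubface s) : t.free ⊆ s.free :=
  fun _ hi => mem_free.2 (h.eq_none (mem_free.1 hi))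

theorem IsSubface.trans {r t s : CubeFace m} (h : r.IsSubface t) (h' : t.IsSubface s) :
    r.IsSubface s := fun i => by
  by_cases hs : s i = none
  · exact Or.inl hs
  · have h1 := h'.eq_of_ne_none hs
    right
    rw [← h1]
    exact h.eq_of_ne_none (by rw [h1]; exact hs)

theorem dim_eq_zero {s : CubeFace m} : s.dim = 0 ↔ ∀ i, s i ≠ none := by
  simp [dim, Finset.card_eq_zero, Finset.eq_empty_iff_forall_notMem, mem_free]

theorem dim_eq_one {s : CubeFace m} : s.dim = 1 ↔ ∃ j, ∀ i, s i = none ↔ i = j := by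
  simp [dim, Finset.card_eq_one, Finset.ext_iff, mem_free]

/-- Freeing one more coordinate of a face. -/
theorem isSubface_update_none (s : CubeFace m) (i : Fin m) :
    s.IsSubface (Function.update s i none) := by
  intro k
  by_cases hk : k = i
  · subst hk; simp
  · right; simp [hk]

end CubeFace

theorem Fin.add_one_ne_self' {n : ℕ} (i : Fin (n + 3)) : i + 1 ≠ i := by simp

theorem Fin.add_one_add_one_ne_self {n : ℕ} (i : Fin (n + 3)) : i + 1 + 1 ≠ i := by
  rw [add_assoc, Ne, add_eq_left, Fin.ext_iff]
  simp [Fin.val_add, Nat.mod_eq_of_lt]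

theorem SimpleGraph.cycleGraph_adj_iff_succ {n : ℕ} {i j : Fin (n + 3)} :
    (cycleGraph (n + 3)).Adj i j ↔ j = i + 1 ∨ i = j + 1 := by
  refine (cycleGraph_adj (n := n + 1)).trans ?_
  rw [sub_eq_iff_eq_add, sub_eq_iff_eq_add, add_comm 1, add_comm 1, or_comm]

/-- The faces of the boundary of a polygon are the sets contained in some edge `{i, i + 1}`. -/
theorem mem_polygonComplex_iff {n : ℕ} {σ : Finset (Fin (n + 3))} :
    σ ∈ polygonComplex (n + 3) ↔ ∃ i, σ ⊆ {i, i + 1} := by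
  constructor
  · rintro ⟨hc, hadj⟩
    rcases (by omega : σ.card = 0 ∨ σ.card = 1 ∨ σ.card = 2) with h | h | h
    · exact ⟨0, by rw [Finset.card_eq_zero.1 h]; simp⟩
    · obtain ⟨a, rfl⟩ := Finset.card_eq_one.1 h
      exact ⟨a, by simp⟩
    · obtain ⟨a, b, hab, rfl⟩ := Finset.card_eq_two.1 h
      rcases SimpleGraph.cycleGraph_adj_iff_succ.1 (hadj a (by simp) b (by simp) hab) with h | h
      · exact ⟨a, by rw [h]⟩
      · exact ⟨b, by rw [h, Finset.pair_comm]⟩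
  · rintro ⟨i, hi⟩
    refine ⟨(Finset.card_le_card hi).trans Finset.card_le_two, fun a ha b hb hab => ?_⟩
    have ha := hi ha
    have hb := hi hb
    simp only [Finset.mem_insert, Finset.mem_singleton] at ha hb
    rw [SimpleGraph.cycleGraph_adj_iff_succ]
    rcases ha with rfl | rfl <;> rcases hb with rfl | rfl <;> simp_all

theorem mem_quadSurface_iff {n : ℕ} {s : CubeFace (n + 3)} :
    s ∈ quadSurface (n + 3) ↔ ∃ i, ∀ k, s k = none → k = i ∨ k = i + 1 := by
  change s.free ∈ polygonComplex (n + 3) ↔ _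
  rw [mem_polygonComplex_iff]
  simp [Finset.subset_iff, CubeFace.mem_free]

theorem quadSurface_of_subface {m : ℕ} {s t : CubeFace m} (hs : s ∈ quadSurface m)
    (h : t.IsSubface s) : t ∈ quadSurface m :=
  ⟨(Finset.card_le_card h.free_subset).trans hs.1,
    fun i hi j hj => hs.2 i (h.free_subset hi) j (h.free_subset hj)⟩

theorem quadSurface_of_dim_zero {m : ℕ} {v : CubeFace m} (hv : v.dim = 0) :
    v ∈ quadSurface m := by
  have : v.free = ∅ := Finset.card_eq_zero.1 hv
  change v.free ∈ polygonComplex m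
  rw [this]
  exact ⟨by simp, by simp⟩

theorem quadSurface_of_dim_one {n : ℕ} {e : CubeFace (n + 3)} (he : e.dim = 1) :
    e ∈ quadSurface (n + 3) := by
  obtain ⟨j, hj⟩ := CubeFace.dim_eq_one.1 he
  exact mem_quadSurface_iff.2 ⟨j, fun k hk => Or.inl ((hj k).1 hk)⟩

theorem quadSurface_and_dim_two_iff {n : ℕ} {f : CubeFace (n + 3)} :
    (f ∈ quadSurface (n + 3) ∧ f.dim = 2) ↔ ∃ i, f.free = {i, i + 1} := by
  constructor
  · rintro ⟨hf, hd⟩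
    obtain ⟨i, hi⟩ := mem_polygonComplex_iff.1 hf
    refine ⟨i, Finset.eq_of_subset_of_card_le hi ?_⟩
    exact Finset.card_le_two.trans hd.ge
  · rintro ⟨i, hi⟩
    refine ⟨mem_polygonComplex_iff.2 ⟨i, hi.le⟩, ?_⟩
    rw [CubeFace.dim, hi, Finset.card_pair (Fin.add_one_ne_self' i).symm]

theorem exists_pair_of_dim_two {n : ℕ} {f : CubeFace (n + 3)} (hf : f ∈ quadSurface (n + 3))
    (hd : f.dim = 2) : ∃ i, ∀ k, f k = none ↔ k = i ∨ k = i + 1 := by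
  obtain ⟨i, hi⟩ := quadSurface_and_dim_two_iff.1 ⟨hf, hd⟩
  exact ⟨i, fun k => by rw [← CubeFace.mem_free, hi]; simp⟩

theorem exists_dim_two_of_mem_quadSurface {n : ℕ} {s : CubeFace (n + 3)}
    (hs : s ∈ quadSurface (n + 3)) :
    ∃ f ∈ quadSurface (n + 3), f.dim = 2 ∧ s.IsSubface f := by
  obtain ⟨i, hi⟩ := mem_quadSurface_iff.1 hs
  let f : CubeFace (n + 3) := fun k => if k = i ∨ k = i + 1 then none else s k
  have hf : f.free = {i, i + 1} := by
    ext k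
    simp only [CubeFace.mem_free, Finset.mem_insert, Finset.mem_singleton, f]
    split_ifs with h
    · simp [h]
    · simp only [h, iff_false]
      exact fun h' => h (hi k h')
  obtain ⟨h1, h2⟩ := quadSurface_and_dim_two_iff.2 ⟨i, hf⟩
  refine ⟨f, h1, h2, fun k => ?_⟩
  simp only [f]
  split_ifs <;> simp

theorem quadSurface_link {n : ℕ} (v : CubeFace (n + 3)) (hd : v.dim = 0) :
    Nonempty (linkGraph (quadSurface (n + 3)) v ≃g SimpleGraph.cycleGraph (n + 3)) := by
  rw [CubeFace.dim_eq_zero] at hd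
  have hfree : ∀ i k, Function.update v i none k = none ↔ k = i := fun i k => by
    by_cases hk : k = i
    · subst hk; simp
    · simp [hk, hd k]
  have hdim : ∀ i, CubeFace.dim (Function.update v i none) = 1 := fun i =>
    CubeFace.dim_eq_one.2 ⟨i, hfree i⟩
  let φ : Fin (n + 3) →
      {e : CubeFace (n + 3) // e ∈ quadSurface (n + 3) ∧ e.dim = 1 ∧ v.IsSubface e} :=
    fun i => ⟨Function.update v i none, quadSurface_of_dim_one (hdim i), hdim i,
      v.isSubface_update_none i⟩
  have hinj : Function.Injective φ := fun i j h => by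
    have h1 : Function.update v i none = Function.update v j none := congrArg Subtype.val h
    exact (hfree j i).1 (by rw [← h1]; simp)
  have hsurj : Function.Surjective φ := by
    rintro ⟨e, he, hd1, hv⟩
    obtain ⟨j, hj⟩ := CubeFace.dim_eq_one.1 hd1
    refine ⟨j, Subtype.ext (funext fun k => ?_)⟩
    by_cases hk : k = j
    · subst hk
      simpa [φ] using ((hj k).2 rfl).symm
    · simpa [φ, hk] using hv.eq_of_ne_none (fun h => hk ((hj k).1 h))
  refine ⟨SimpleGraph.Iso.symm ⟨Equiv.ofBijective φ ⟨hinj, hsurj⟩, ?_⟩⟩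
  intro i j
  change (φ i ≠ φ j ∧ _) ↔ _
  constructor
  · rintro ⟨hne, f, hf, -, h1, h2⟩
    change (φ i).1.IsSubface f at h1
    change (φ j).1.IsSubface f at h2
    have hi : f i = none := h1.eq_none (by simp [φ])
    have hj : f j = none := h2.eq_none (by simp [φ])
    exact hf.2 i (CubeFace.mem_free.2 hi) j (CubeFace.mem_free.2 hj) fun h => hne (by rw [h])
  · intro h
    have hij : i ≠ j := h.ne
    refine ⟨fun h => hij (hinj h), Function.update (Function.update v i none) j none, ?_⟩
    have hf : CubeFace.free (Function.update (Function.update v i none) j none) = {i, j} := by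
      ext k
      rw [CubeFace.mem_free, Finset.mem_insert, Finset.mem_singleton]
      by_cases hk : k = j
      · subst hk; simp
      · simp [hk, hfree]
    have h2 : CubeFace.dim (Function.update (Function.update v i none) j none) = 2 := by
      rw [CubeFace.dim, hf, Finset.card_pair hij]
    refine ⟨⟨h2.le, ?_⟩, h2, CubeFace.isSubface_update_none _ j, ?_⟩
    · intro a ha b hb hab
      rw [hf] at ha hb
      simp only [Finset.mem_insert, Finset.mem_singleton] at ha hb
      rcases ha with rfl | rfl <;> rcases hb with rfl | rfl
      · exact absurd rfl hab
      · exact h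
      · exact h.symm
      · exact absurd rfl hab
    · rw [Function.update_comm hij]
      exact CubeFace.isSubface_update_none _ i

theorem quadSurface_connected (n : ℕ) : (skeletonGraph (quadSurface (n + 3))).Connected := by
  have key : ∀ (N : ℕ) (v w : {v : CubeFace (n + 3) // v ∈ quadSurface (n + 3) ∧ v.dim = 0}),
      (Finset.univ.filter fun i => v.1 i ≠ w.1 i).card = N →
      (skeletonGraph (quadSurface (n + 3))).Reachable v w := by
    intro N
    induction N with
    | zero =>
      intro v w h
      rw [Finset.card_eq_zero, Finset.filter_eq_empty_iff] at h
      have : v = w := Subtype.ext (funext fun i => not_not.1 (h (Finset.mem_univ i)))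
      rw [this]
    | succ N ih =>
      intro v w h
      obtain ⟨i, hi⟩ : (Finset.univ.filter fun i => v.1 i ≠ w.1 i).Nonempty := by
        rw [← Finset.card_pos]; omega
      have hi' : v.1 i ≠ w.1 i := (Finset.mem_filter.1 hi).2
      have hv0 := CubeFace.dim_eq_zero.1 v.2.2
      have hw0 := CubeFace.dim_eq_zero.1 w.2.2
      have hu : CubeFace.dim (Function.update v.1 i (w.1 i)) = 0 := by
        rw [CubeFace.dim_eq_zero]
        intro k
        by_cases hk : k = i
        · subst hk; simpa using hw0 k
        · simpa [hk] using hv0 k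
      have he : CubeFace.dim (Function.update v.1 i none) = 1 := by
        refine CubeFace.dim_eq_one.2 ⟨i, fun k => ?_⟩
        by_cases hk : k = i
        · subst hk; simp
        · simp [hk, hv0 k]
      let u : {v : CubeFace (n + 3) // v ∈ quadSurface (n + 3) ∧ v.dim = 0} :=
        ⟨Function.update v.1 i (w.1 i), quadSurface_of_dim_zero hu, hu⟩
      have huw : (skeletonGraph (quadSurface (n + 3))).Reachable u w := by
        refine ih u w ?_
        have : (Finset.univ.filter fun k => u.1 k ≠ w.1 k) =
            (Finset.univ.filter fun k => v.1 k ≠ w.1 k).erase i := by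
          ext k
          by_cases hk : k = i
          · subst hk; simp [u]
          · simp [u, hk]
        rw [this, Finset.card_erase_of_mem hi, h]
        rfl
      refine SimpleGraph.Reachable.trans (SimpleGraph.Adj.reachable ?_) huw
      refine ⟨fun h => hi' ?_, Function.update v.1 i none, quadSurface_of_dim_one he, he,
        CubeFace.isSubface_update_none _ i, ?_⟩
      · have := congrFun (congrArg Subtype.val h) i
        simpa [u] using this
      · have := CubeFace.isSubface_update_none (Function.update v.1 i (w.1 i)) i
        simpa using this
  have h0 : CubeFace.dim (fun _ : Fin (n + 3) => some false) = 0 := by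
    simp [CubeFace.dim_eq_zero]
  have : Nonempty {v : CubeFace (n + 3) // v ∈ quadSurface (n + 3) ∧ v.dim = 0} :=
    ⟨⟨_, quadSurface_of_dim_zero h0, h0⟩⟩
  exact ⟨fun v w => key _ v w rfl⟩

/-- The parity of the number of fixed coordinates of a face that are equal to `1`. -/
def CubeFace.parity {m : ℕ} (s : CubeFace m) : ZMod 2 :=
  ∑ k, if s k = some true then 1 else 0

/-- The orientation of the quad-surface: in the 2-face `f` with free coordinates `i`, `i + 1`, the
edge `e` is directed towards the vertex whose coordinate in the free direction `j` of `e` is the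
parity of `e`, reversed when `j = i`. -/
def quadHead {n : ℕ} (f e : CubeFace (n + 3)) : CubeFace (n + 3) := fun j =>
  if e j = none then some (decide (e.parity + (if f (j + 1) = none then 1 else 0) = 1)) else e j

theorem ite_decide_eq_true_eq (a : ZMod 2) :
    (if (some (decide (a = 1)) : Option Bool) = some true then (1 : ZMod 2) else 0) = a := by
  revert a; decide

/-- The parity of an edge of `f` is the parity of `f` plus the coordinate that is fixed on the edge
but free on `f`. -/
theorem CubeFace.parity_eq_of_subface {n : ℕ} {e f : CubeFace (n + 3)} {i j j' : Fin (n + 3)}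
    (hf : ∀ k, f k = none ↔ k = j ∨ k = j') (he : ∀ k, e k = none ↔ k = j) (hef : e.IsSubface f)
    (hi : i = j') (hjj : j ≠ j') :
    e.parity = (∑ k, if f k = some true then 1 else 0) + if e i = some true then 1 else 0 := by
  subst hi
  have : ∀ k, (if e k = some true then (1 : ZMod 2) else 0) =
      (if f k = some true then 1 else 0) +
        if k = i then (if e i = some true then 1 else 0) else 0 := by
    intro k
    by_cases hk : k = i
    · subst hk
      have : f k = none := (hf k).2 (Or.inr rfl)
      simp [this]
    · by_cases hk' : k = j
      · subst hk'
        have h1 : f k = none := (hf k).2 (Or.inl rfl)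
        have h2 : e k = none := (he k).2 rfl
        simp [h1, h2, hk]
      · have : e k = f k := hef.eq_of_ne_none fun h => by
          rcases (hf k).1 h with h | h
          · exact hk' h
          · exact hk h
        simp [this, hk]
  rw [CubeFace.parity, Finset.sum_congr rfl fun k _ => this k, Finset.sum_add_distrib,
    Finset.sum_ite_eq' Finset.univ i]
  simp

theorem quadSurface_orientable (n : ℕ) : IsOrientable (quadSurface (n + 3)) := by
  refine ⟨quadHead, ?_, ?_, ?_⟩
  · intro f hf hfd e he hed hef
    refine ⟨CubeFace.dim_eq_zero.2 fun i => ?_, fun i => ?_⟩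
    · unfold quadHead; split_ifs with h <;> simp [h]
    · unfold quadHead; split_ifs with h <;> simp [h]
  · intro f hf hfd e he hed hef e' he' hed' hef' hne heq
    obtain ⟨i, hi⟩ := exists_pair_of_dim_two hf hfd
    obtain ⟨j, hj⟩ := CubeFace.dim_eq_one.1 hed
    obtain ⟨j', hj'⟩ := CubeFace.dim_eq_one.1 hed'
    -- Two edges of `f` with the same free coordinate differ in a fixed coordinate.
    have hsame : j ≠ j' := by
      rintro rfl
      refine hne (funext fun k => ?_)
      by_cases hk : k = j
      · rw [(hj k).2 hk, (hj' k).2 hk]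
      · have h1 := congrFun heq k
        have h2 : e k ≠ none := fun h => hk ((hj k).1 h)
        have h3 : e' k ≠ none := fun h => hk ((hj' k).1 h)
        simpa [quadHead, h2, h3] using h1
    -- If edges in different directions had the same head, then its coordinates `x` and `y` in these
    -- directions would satisfy `y = P + x` and `x = P + y + 1`, where `P` is the parity of `f`.
    have key : ∀ a b : CubeFace (n + 3), a.IsSubface f → b.IsSubface f →
        (∀ k, a k = none ↔ k = i) → (∀ k, b k = none ↔ k = i + 1) →
        quadHead f a ≠ quadHead f b := by
      intro a b haf hbf ha hb hab
      have hpa := CubeFace.parity_eq_of_subface hi ha haf rfl (Fin.add_one_ne_self' i).symm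
      have hpb := CubeFace.parity_eq_of_subface (fun k => (hi k).trans or_comm) hb hbf rfl
        (Fin.add_one_ne_self' i)
      have hfi : f (i + 1) = none := (hi _).2 (Or.inr rfl)
      have hfi2 : f (i + 1 + 1) ≠ none := fun h => by
        rcases (hi _).1 h with h | h
        · exact Fin.add_one_add_one_ne_self i h
        · exact Fin.add_one_ne_self' _ h
      have h1 := congrFun hab i
      have h2 := congrFun hab (i + 1)
      have hai : a i = none := (ha i).2 rfl
      have hbi : b (i + 1) = none := (hb _).2 rfl
      have hai1 : a (i + 1) ≠ none := fun h => Fin.add_one_ne_self' i ((ha _).1 h)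
      have hbi0 : b i ≠ none := fun h => (Fin.add_one_ne_self' i).symm ((hb _).1 h)
      simp only [quadHead, hai, hbi, hai1, hbi0, hfi, hfi2, if_true, if_false, add_zero] at h1 h2
      rw [← h1, ite_decide_eq_true_eq] at hpb
      rw [h2, ite_decide_eq_true_eq, hpb] at hpa
      generalize (∑ k, if f k = some true then (1 : ZMod 2) else 0) = P at hpa
      generalize a.parity = A at hpa
      revert P A
      decide
    have hfj : j = i ∨ j = i + 1 := (hi j).1 (hef.eq_none ((hj j).2 rfl))
    have hfj' : j' = i ∨ j' = i + 1 := (hi j').1 (hef'.eq_none ((hj' j').2 rfl))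
    rcases hfj with rfl | rfl <;> rcases hfj' with rfl | rfl
    · exact hsame rfl
    · exact key e e' hef hef' hj hj' heq
    · exact key e' e hef' hef hj' hj heq.symm
    · exact hsame rfl
  · intro f hf hfd f' hf' hfd' hne e he hed hef hef' heq
    obtain ⟨i, hi⟩ := exists_pair_of_dim_two hf hfd
    obtain ⟨i', hi'⟩ := exists_pair_of_dim_two hf' hfd'
    obtain ⟨j, hj⟩ := CubeFace.dim_eq_one.1 hed
    have hej : e j = none := (hj j).2 rfl
    have h1 := congrFun heq j
    simp only [quadHead, hej, if_true] at h1
    have h2 : f (j + 1) = none ↔ f' (j + 1) = none := by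
      by_cases ha : f (j + 1) = none <;> by_cases hb : f' (j + 1) = none <;>
        simp only [ha, hb, if_true, if_false] at h1 ⊢
      all_goals
        exfalso
        generalize e.parity = A at h1
        revert A
        decide
    have hii : i = i' := by
      have ha : j = i ∨ j = i + 1 := (hi j).1 (hef.eq_none hej)
      have hb : j = i' ∨ j = i' + 1 := (hi' j).1 (hef'.eq_none hej)
      rw [hi, hi'] at h2
      rcases ha with rfl | rfl <;> rcases hb with rfl | hb
      · rfl
      · exfalso
        rcases h2.1 (Or.inr rfl) with h | h
        · rw [hb] at h; exact Fin.add_one_add_one_ne_self i' h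
        · rw [hb] at h; exact Fin.add_one_ne_self' _ h
      · exfalso
        rcases h2.2 (Or.inr rfl) with h | h
        · exact Fin.add_one_add_one_ne_self i h
        · exact Fin.add_one_ne_self' _ h
      · exact add_right_cancel hb
    subst hii
    refine hne (funext fun k => ?_)
    by_cases hk : f k = none
    · rw [hk, (hi' k).2 ((hi k).1 hk)]
    · rw [← hef.eq_of_ne_none hk, hef'.eq_of_ne_none fun h => hk ((hi k).2 ((hi' k).1 h))]

theorem quadSurface_isCombinatorialSurface (n : ℕ) :
    IsCombinatorialSurface (quadSurface (n + 3)) where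
  subface_mem _ hs _ ht := quadSurface_of_subface hs ht
  pure s hs := ⟨hs.1, exists_dim_two_of_mem_quadSurface hs⟩
  link v _ hd := ⟨n + 3, by omega, quadSurface_link v hd⟩
  connected := quadSurface_connected n
  orientable := quadSurface_orientable n
  inter s hs t ht := by
    by_cases h : ∃ u ∈ quadSurface (n + 3), u.IsSubface s ∧ u.IsSubface t
    · left
      obtain ⟨u, -, hus, hut⟩ := h
      let r : CubeFace (n + 3) := fun i => if s i = none then t i else s i
      have hr : ∀ w : CubeFace (n + 3), (w.IsSubface s ∧ w.IsSubface t) ↔ w.IsSubface r := by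
        intro w
        constructor
        · rintro ⟨h1, h2⟩ i
          by_cases hi : s i = none
          · simpa [r, hi] using h2 i
          · simpa [r, hi] using h1 i
        · intro h
          constructor <;> intro i
          · have := h i
            by_cases hi : s i = none
            · exact Or.inl hi
            · simpa [r, hi] using this
          · have := h i
            by_cases hi : s i = none
            · simpa [r, hi] using this
            · by_cases hti : t i = none
              · exact Or.inl hti
              · right
                have h1 : w i = s i := by simpa [r, hi] using this
                rw [h1, ← hus.eq_of_ne_none hi, hut.eq_of_ne_none hti]
      exact ⟨r, quadSurface_of_subface hs ((hr r).2 (CubeFace.IsSubface.refl r)).1,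
        fun w _ => hr w⟩
    · exact Or.inr h

/-! ### Face numbers -/

theorem card_filter_free_eq {m : ℕ} (σ : Finset (Fin m)) :
    (Finset.univ.filter fun s : CubeFace m => s.free = σ).card = 2 ^ (m - σ.card) := by
  have : (Finset.univ.filter fun s : CubeFace m => s.free = σ) =
      Fintype.piFinset fun i => if i ∈ σ then {none} else {some true, some false} := by
    ext s
    simp only [Finset.mem_filter, Finset.mem_univ, true_and, Fintype.mem_piFinset,
      Finset.ext_iff, CubeFace.mem_free]
    refine forall_congr' fun i => ?_
    by_cases hi : i ∈ σ
    · simp [hi]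
    · rcases s i with _ | _ | _ <;> simp [hi]
  rw [this, Fintype.card_piFinset]
  have h2 : ∀ i, (if i ∈ σ then {none} else {some true, some false} : Finset (Option Bool)).card =
      if i ∈ σ then 1 else 2 := fun i => by split_ifs <;> rfl
  simp only [h2]
  rw [Finset.prod_ite]
  simp only [Finset.prod_const, one_pow, one_mul]
  congr 1
  rw [Finset.filter_not, Finset.card_sdiff]
  simp

theorem numFaces_eq_of_free {m k : ℕ} {Q : Set (CubeFace m)} (S : Finset (Finset (Fin m)))
    (hS : ∀ s : CubeFace m, (s ∈ Q ∧ s.dim = k) ↔ s.free ∈ S) (hk : ∀ σ ∈ S, σ.card = k) :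
    numFaces Q k = S.card * 2 ^ (m - k) := by
  have : {s : CubeFace m | s ∈ Q ∧ s.dim = k} =
      ((Finset.univ.filter fun s : CubeFace m => s.free ∈ S : Finset _) : Set (CubeFace m)) := by
    ext s; simp [hS]
  rw [numFaces, this, Set.ncard_coe_finset,
    Finset.card_eq_sum_card_fiberwise (f := CubeFace.free) (t := S)
      (fun s hs => by simpa using hs)]
  rw [Finset.sum_congr rfl (g := fun _ => 2 ^ (m - k)), Finset.sum_const, smul_eq_mul]
  intro σ hσ
  rw [← hk σ hσ, ← card_filter_free_eq, Finset.filter_filter]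
  congr 1
  ext s
  simp only [Finset.mem_filter, Finset.mem_univ, true_and, and_iff_right_iff_imp]
  rintro rfl
  exact hσ

theorem numFaces_quadSurface_zero (n : ℕ) : numFaces (quadSurface (n + 3)) 0 = 2 ^ (n + 3) := by
  rw [numFaces_eq_of_free {∅}]
  · simp
  · intro s
    rw [Finset.mem_singleton, ← Finset.card_eq_zero]
    exact and_iff_right_of_imp quadSurface_of_dim_zero
  · simp

theorem numFaces_quadSurface_one (n : ℕ) :
    numFaces (quadSurface (n + 3)) 1 = (n + 3) * 2 ^ (n + 2) := by
  rw [numFaces_eq_of_free (Finset.univ.image fun i : Fin (n + 3) => {i})]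
  · rw [Finset.card_image_of_injective _ Finset.singleton_injective]
    simp
  · intro s
    rw [and_iff_right_of_imp quadSurface_of_dim_one, CubeFace.dim, Finset.card_eq_one]
    simp [eq_comm]
  · simp

theorem numFaces_quadSurface_two (n : ℕ) :
    numFaces (quadSurface (n + 3)) 2 = (n + 3) * 2 ^ (n + 1) := by
  rw [numFaces_eq_of_free (Finset.univ.image fun i : Fin (n + 3) => {i, i + 1})]
  · rw [Finset.card_image_of_injective]
    · simp
    · intro i j (h : ({i, i + 1} : Finset (Fin (n + 3))) = {j, j + 1})
      have h1 : i = j ∨ i = j + 1 := by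
        have : i ∈ ({i, i + 1} : Finset (Fin (n + 3))) := by simp
        simpa [h] using this
      rcases h1 with h1 | rfl
      · exact h1
      · exfalso
        have : j + 1 + 1 ∈ ({j + 1, j + 1 + 1} : Finset (Fin (n + 3))) := by simp
        rw [h, Finset.mem_insert, Finset.mem_singleton] at this
        rcases this with h | h
        · exact Fin.add_one_add_one_ne_self j h
        · exact Fin.add_one_ne_self' _ h
  · intro s
    rw [quadSurface_and_dim_two_iff]
    simp [eq_comm]
  · intro σ hσ
    obtain ⟨i, -, rfl⟩ := Finset.mem_image.1 hσ
    exact Finset.card_pair (Fin.add_one_ne_self' i).symm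

theorem genus_quadSurface (n : ℕ) :
    genus (quadSurface (n + 3)) = 1 + (((n + 3 : ℕ) : ℚ) - 4) * 2 ^ n := by
  rw [genus, numFaces_quadSurface_zero, numFaces_quadSurface_one, numFaces_quadSurface_two]
  push_cast
  ring

/-! ### The inequalities of the deformed cube -/

/-- The sign that belongs to a fixed coordinate: `1` for `true`, and `-1` for `false`. -/
noncomputable def boolSign (β : Bool) : ℝ := if β then 1 else -1

theorem abs_boolSign (β : Bool) : |boolSign β| = 1 := by
  cases β <;> simp [boolSign]

/-- The left-hand side of the `i`-th inequality of the deformed cube, with the sign given by `β`. -/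
noncomputable def cubeRow (m : ℕ) (ε : ℝ) (β : Bool) (i : Fin m) : Module.Dual ℝ (Fin m → ℝ) :=
  (LinearMap.proj i).comp (Matrix.mulVecLin (deformedMatrix m (boolSign β * ε)))

/-- The part of `cubeRow` below the diagonal; it only depends on the preceding coordinates. -/
noncomputable def bandRow (m : ℕ) (i : Fin m) : Module.Dual ℝ (Fin m → ℝ) :=
  (LinearMap.proj i).comp (Matrix.mulVecLin (deformedMatrix m 0))

theorem cubeRow_eq_mulVec {m : ℕ} (ε : ℝ) (β : Bool) (i : Fin m) (x : Fin m → ℝ) :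
    cubeRow m ε β i x = (deformedMatrix m (boolSign β * ε)).mulVec x i := rfl

theorem deformedMatrix_eq_add {m : ℕ} (δ : ℝ) (i j : Fin m) :
    deformedMatrix m δ i j = (if i = j then δ else 0) + deformedMatrix m 0 i j := by
  simp only [deformedMatrix, Matrix.of_apply, Fin.ext_iff]
  split_ifs <;> simp

theorem cubeRow_apply {m : ℕ} (ε : ℝ) (β : Bool) (i : Fin m) (x : Fin m → ℝ) :
    cubeRow m ε β i x = boolSign β * ε * x i + bandRow m i x := by
  simp only [cubeRow, bandRow, LinearMap.comp_apply, LinearMap.proj_apply, Matrix.mulVecLin_apply,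
    Matrix.mulVec, dotProduct]
  simp_rw [deformedMatrix_eq_add (boolSign β * ε), add_mul, ite_mul, zero_mul]
  rw [Finset.sum_add_distrib, Finset.sum_ite_eq Finset.univ i]
  simp

/-- The sequence `x` shifted by four and continued by zeros in both directions. -/
noncomputable def shiftPad {m : ℕ} (x : Fin m → ℝ) (n : ℕ) : ℝ :=
  if h : 4 ≤ n ∧ n - 4 < m then x ⟨n - 4, h.2⟩ else 0

theorem sum_ite_eq_shiftPad {m : ℕ} (x : Fin m → ℝ) (n : ℕ) :
    (∑ j : Fin m, if (j : ℕ) + 4 = n then x j else 0) = shiftPad x n := by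
  unfold shiftPad
  split_ifs with h
  · rw [Finset.sum_eq_single (⟨n - 4, h.2⟩ : Fin m)]
    · rw [if_pos]
      simp only
      omega
    · intro j _ hj
      rw [if_neg]
      intro h'
      exact hj (Fin.ext (by simp only; omega))
    · simp
  · refine Finset.sum_eq_zero fun j _ => if_neg fun h' => h ⟨by omega, ?_⟩
    have := j.2
    omega

theorem bandRow_apply {m : ℕ} (i : Fin m) (x : Fin m → ℝ) :
    bandRow m i x = 2 * shiftPad x (i + 3) - 7 * shiftPad x (i + 2) + 7 * shiftPad x (i + 1)
      - 2 * shiftPad x i := by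
  simp only [bandRow, LinearMap.comp_apply, LinearMap.proj_apply, Matrix.mulVecLin_apply,
    Matrix.mulVec, dotProduct, ← sum_ite_eq_shiftPad, Finset.mul_sum]
  rw [← Finset.sum_sub_distrib, ← Finset.sum_add_distrib, ← Finset.sum_sub_distrib]
  refine Finset.sum_congr rfl fun j _ => ?_
  simp only [deformedMatrix, Matrix.of_apply]
  split_ifs <;> first | omega | ring

theorem bandRow_congr {m : ℕ} {i : Fin m} {x y : Fin m → ℝ} (h : ∀ j < i, x j = y j) :
    bandRow m i x = bandRow m i y := by
  have : ∀ n, n < (i : ℕ) + 4 → shiftPad x n = shiftPad y n := by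
    intro n hn
    unfold shiftPad
    split_ifs with h'
    · exact h _ (Fin.lt_def.2 (by simp only; omega))
    · rfl
  simp only [bandRow_apply]
  rw [this _ (by omega), this _ (by omega), this _ (by omega), this _ (by omega)]

theorem mem_deformedCube_iff {m : ℕ} {ε : ℝ} {b x : Fin m → ℝ} :
    x ∈ deformedCube m ε b ↔ ∀ β i, cubeRow m ε β i x ≤ b i := by
  simp [deformedCube, cubeRow_eq_mulVec, boolSign, forall_and, and_comm]

/-! ### The deformed cube is a cube -/

section Cube

variable {m : ℕ} {ε : ℝ} {b : Fin m → ℝ}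

theorem GrowsFast.le_pow_mul (hb : GrowsFast ε b) (hε : 0 < ε) (d : ℕ) (j k : Fin m)
    (h : (j : ℕ) + d = k) : b j ≤ (ε / 6) ^ d * b k := by
  induction d generalizing k with
  | zero =>
    have : j = k := Fin.ext (by simpa using h)
    simp [this]
  | succ d ih =>
    have hk := k.2
    have h1 := ih ⟨j + d, by omega⟩ rfl
    have h2 := hb.2 ⟨j + d, by omega⟩ k (by simp only; omega)
    calc b j ≤ (ε / 6) ^ d * b ⟨j + d, by omega⟩ := h1
      _ = (ε / 6) ^ (d + 1) * (6 / ε * b ⟨j + d, by omega⟩) := by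
        rw [pow_succ]
        field_simp
      _ ≤ _ := by gcongr

/-- If the preceding coordinates satisfy the bounds that hold on the deformed cube, then the
`k`-th pair of inequalities leaves a nondegenerate interval for the `k`-th coordinate. -/
theorem GrowsFast.abs_bandRow_lt (hb : GrowsFast ε b) (hε : 0 < ε) (hε' : ε ≤ 1 / 2)
    {x : Fin m → ℝ} {k : Fin m} (hx : ∀ j < k, |x j| ≤ 2 * b j / ε) : |bandRow m k x| < b k := by
  have hbk := hb.1 k
  have hpad : ∀ d n : ℕ, n + d = k + 4 → 1 ≤ d →
      |shiftPad x n| ≤ 2 / ε * ((ε / 6) ^ d * b k) := by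
    intro d n hn hd
    unfold shiftPad
    split_ifs with h
    · refine (hx _ (Fin.lt_def.2 (by simp only; omega))).trans ?_
      have := hb.le_pow_mul hε d ⟨n - 4, h.2⟩ k (by simp only; omega)
      calc 2 * b ⟨n - 4, h.2⟩ / ε = 2 / ε * b ⟨n - 4, h.2⟩ := by ring
        _ ≤ _ := by gcongr
    · rw [abs_zero]; positivity
  have h1 := abs_le.1 (hpad 1 (k + 3) (by omega) le_rfl)
  have h2 := abs_le.1 (hpad 2 (k + 2) (by omega) (by norm_num))
  have h3 := abs_le.1 (hpad 3 (k + 1) (by omega) (by norm_num))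
  have h4 := abs_le.1 (hpad 4 k (by omega) (by norm_num))
  -- The four terms contribute at most `2/3`, `7 ε / 18`, `7 ε² / 108` and `ε³ / 324` times `b k`.
  have e1 : 2 / ε * ((ε / 6) ^ 1 * b k) = b k / 3 := by field_simp; norm_num
  have e2 : 2 / ε * ((ε / 6) ^ 2 * b k) = ε * (b k / 18) := by field_simp; norm_num
  have e3 : 2 / ε * ((ε / 6) ^ 3 * b k) = ε * ε * (b k / 108) := by field_simp; norm_num
  have e4 : 2 / ε * ((ε / 6) ^ 4 * b k) = ε * ε * ε * (b k / 648) := by field_simp; norm_num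
  have f2 : ε * (b k / 18) ≤ 1 / 2 * (b k / 18) := by gcongr
  have f3 : ε * ε * (b k / 108) ≤ 1 / 2 * (1 / 2) * (b k / 108) := by gcongr
  have f4 : ε * ε * ε * (b k / 648) ≤ 1 / 2 * (1 / 2) * (1 / 2) * (b k / 648) := by gcongr
  rw [e1] at h1
  rw [e2] at h2
  rw [e3] at h3
  rw [e4] at h4
  rw [bandRow_apply, abs_lt]
  constructor <;> linarith [h1.1, h1.2, h2.1, h2.2, h3.1, h3.2, h4.1, h4.2]

theorem GrowsFast.abs_le_of_abs_mul_le (hb : GrowsFast ε b) (hε : 0 < ε) (hε' : ε ≤ 1 / 2)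
    {x : Fin m → ℝ} (hx : ∀ k, |ε * x k| ≤ |b k - bandRow m k x|) (k : Fin m) :
    |x k| ≤ 2 * b k / ε := by
  induction k using WellFoundedLT.induction with
  | ind k ih =>
    have h1 := abs_lt.1 (hb.abs_bandRow_lt hε hε' ih)
    have h2 := hx k
    rw [abs_mul, abs_of_pos hε, abs_of_pos (by linarith : 0 < b k - bandRow m k x)] at h2
    rw [le_div_iff₀ hε]
    linarith

theorem abs_mul_le_of_mem_deformedCube {x : Fin m → ℝ} (hx : x ∈ deformedCube m ε b) (k : Fin m) :
    |ε * x k| ≤ b k - bandRow m k x := by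
  rw [mem_deformedCube_iff] at hx
  have h1 := hx true k
  have h2 := hx false k
  rw [cubeRow_apply] at h1 h2
  simp only [boolSign, if_true, Bool.false_eq_true, if_false] at h1 h2
  rw [abs_le]
  constructor <;> linarith

theorem abs_le_of_mem_deformedCube (hε : 0 < ε) (hε' : ε ≤ 1 / 2) (hb : GrowsFast ε b)
    {x : Fin m → ℝ} (hx : x ∈ deformedCube m ε b) (k : Fin m) : |x k| ≤ 2 * b k / ε :=
  hb.abs_le_of_abs_mul_le hε hε'
    (fun k => (abs_mul_le_of_mem_deformedCube hx k).trans (le_abs_self _)) k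

/-- Opposite inequalities are not tight at the same time. -/
theorem cubeRow_bnot_lt_of_eq (hε : 0 < ε) (hε' : ε ≤ 1 / 2) (hb : GrowsFast ε b)
    {x : Fin m → ℝ} (hx : x ∈ deformedCube m ε b) {β : Bool} {k : Fin m}
    (h : cubeRow m ε β k x = b k) : cubeRow m ε (!β) k x < b k := by
  have h1 := (abs_lt.1 (hb.abs_bandRow_lt hε hε' (k := k)
    fun j _ => abs_le_of_mem_deformedCube hε hε' hb hx j)).2
  rw [cubeRow_apply] at h ⊢
  cases β <;> simp only [boolSign, Bool.not_true, Bool.not_false, if_true, Bool.false_eq_true,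
    if_false] at h ⊢ <;> linarith

/-- The deformed cube has a vertex for each choice of signs. -/
theorem exists_mem_deformedCube_of_signs (hε : 0 < ε) (hε' : ε ≤ 1 / 2) (hb : GrowsFast ε b)
    (σ : Fin m → Bool) : ∃ x ∈ deformedCube m ε b, ∀ i, cubeRow m ε (σ i) i x = b i := by
  let N : Matrix (Fin m) (Fin m) ℝ :=
    Matrix.of fun i j => deformedMatrix m (boolSign (σ i) * ε) i j
  have hN : N.IsLowerTriangular := by
    intro i j hij
    have hij : (i : ℕ) < j := hij
    simp only [N, Matrix.of_apply, deformedMatrix]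
    rw [if_neg (by omega), if_neg (by omega), if_neg (by omega), if_neg (by omega),
      if_neg (by omega)]
  have hdet : IsUnit N.det := by
    rw [Matrix.det_of_isLowerTriangular _ hN, isUnit_iff_ne_zero, Finset.prod_ne_zero_iff]
    intro i _
    have : boolSign (σ i) ≠ 0 := fun h => by simpa [h] using abs_boolSign (σ i)
    simpa [N, deformedMatrix] using ⟨this, hε.ne'⟩
  have hx : ∀ i, cubeRow m ε (σ i) i (N⁻¹.mulVec b) = b i := by
    intro i
    have : N.mulVec (N⁻¹.mulVec b) = b := by
      rw [Matrix.mulVec_mulVec, Matrix.mul_nonsing_inv _ hdet, Matrix.one_mulVec]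
    exact congrFun this i
  generalize N⁻¹.mulVec b = x at hx
  have heq : ∀ i, boolSign (σ i) * (ε * x i) = b i - bandRow m i x := fun i => by
    rw [← hx i, cubeRow_apply]; ring
  have hle : ∀ i, |ε * x i| ≤ |b i - bandRow m i x| := fun i => by
    rw [← heq, abs_mul (boolSign _), abs_boolSign, one_mul]
  refine ⟨x, mem_deformedCube_iff.2 fun β i => ?_, hx⟩
  have hlt := abs_lt.1 (hb.abs_bandRow_lt hε hε' (k := i)
    fun j _ => hb.abs_le_of_abs_mul_le hε hε' hle j)
  have h1 := heq i
  rw [cubeRow_apply]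
  cases β <;> cases h : σ i <;> rw [h] at h1 <;>
    simp only [boolSign, if_true, Bool.false_eq_true, if_false] at h1 ⊢ <;> linarith

/-- The face of the deformed cube that corresponds to a face of the standard cube: the inequalities
given by the fixed coordinates are tight. -/
def deformedFace (m : ℕ) (ε : ℝ) (b : Fin m → ℝ) (s : CubeFace m) : Set (Fin m → ℝ) :=
  {x ∈ deformedCube m ε b | ∀ i β, s i = some β → cubeRow m ε β i x = b i}

theorem deformedFace_subset_cube (s : CubeFace m) :
    deformedFace m ε b s ⊆ deformedCube m ε b := fun _ hx => hx.1

theorem deformedFace_mono {s t : CubeFace m} (h : t.IsSubface s) :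
    deformedFace m ε b t ⊆ deformedFace m ε b s := fun _ hx =>
  ⟨hx.1, fun i β hi => hx.2 i β (by rw [h.eq_of_ne_none (by simp [hi]), hi])⟩

theorem convex_deformedCube : Convex ℝ (deformedCube m ε b) := by
  intro x hx y hy p q hp hq hpq
  rw [mem_deformedCube_iff] at *
  intro β i
  rw [map_add, map_smul, map_smul, smul_eq_mul, smul_eq_mul]
  calc _ ≤ p * b i + q * b i :=
        add_le_add (mul_le_mul_of_nonneg_left (hx β i) hp) (mul_le_mul_of_nonneg_left (hy β i) hq)
    _ = b i := by rw [← add_mul, hpq, one_mul]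

theorem convex_deformedFace (s : CubeFace m) : Convex ℝ (deformedFace m ε b s) := by
  intro x hx y hy p q hp hq hpq
  refine ⟨convex_deformedCube hx.1 hy.1 hp hq hpq, fun i β hi => ?_⟩
  rw [map_add, map_smul, map_smul, smul_eq_mul, smul_eq_mul, hx.2 i β hi, hy.2 i β hi, ← add_mul,
    hpq, one_mul]

theorem isExtreme_deformedFace (s : CubeFace m) :
    IsExtreme ℝ (deformedCube m ε b) (deformedFace m ε b s) := by
  refine ⟨deformedFace_subset_cube s, fun x hx y hy z hz hxy => ⟨hx, fun i β hi => ?_⟩⟩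
  obtain ⟨p, q, hp, hq, hpq, rfl⟩ := hxy
  have h1 := hz.2 i β hi
  rw [map_add, map_smul, map_smul, smul_eq_mul, smul_eq_mul] at h1
  have h2 := mem_deformedCube_iff.1 hx β i
  have h3 := mul_le_mul_of_nonneg_left (mem_deformedCube_iff.1 hy β i) hq.le
  refine le_antisymm h2 (le_of_mul_le_mul_left ?_ hp)
  have : b i = p * b i + q * b i := by rw [← add_mul, hpq, one_mul]
  linarith

theorem nonempty_deformedFace (hε : 0 < ε) (hε' : ε ≤ 1 / 2) (hb : GrowsFast ε b)
    (s : CubeFace m) : (deformedFace m ε b s).Nonempty := by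
  obtain ⟨x, hx, h⟩ := exists_mem_deformedCube_of_signs hε hε' hb fun i => (s i).getD true
  exact ⟨x, hx, fun i β hi => by simpa [hi] using h i⟩

open Classical in
/-- The smallest face of the deformed cube that contains `x`, as a word. -/
noncomputable def tightWord (m : ℕ) (ε : ℝ) (b : Fin m → ℝ) (x : Fin m → ℝ) : CubeFace m :=
  fun i => if cubeRow m ε true i x = b i then some true else
    if cubeRow m ε false i x = b i then some false else none

theorem tightWord_eq_some_iff (hε : 0 < ε) (hε' : ε ≤ 1 / 2) (hb : GrowsFast ε b)
    {x : Fin m → ℝ} (hx : x ∈ deformedCube m ε b) (i : Fin m) (β : Bool) :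
    tightWord m ε b x i = some β ↔ cubeRow m ε β i x = b i := by
  unfold tightWord
  by_cases h : cubeRow m ε true i x = b i
  · have := (cubeRow_bnot_lt_of_eq hε hε' hb hx h).ne
    rw [Bool.not_true] at this
    cases β <;> simp [h, this]
  · by_cases h' : cubeRow m ε false i x = b i <;> cases β <;> simp [h, h']

theorem mem_deformedFace_iff (hε : 0 < ε) (hε' : ε ≤ 1 / 2) (hb : GrowsFast ε b)
    {x : Fin m → ℝ} (hx : x ∈ deformedCube m ε b) (s : CubeFace m) :
    x ∈ deformedFace m ε b s ↔ (tightWord m ε b x).IsSubface s := by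
  constructor
  · intro h i
    rcases hs : s i with _ | β
    · exact Or.inl rfl
    · exact Or.inr ((tightWord_eq_some_iff hε hε' hb hx i β).2 (h.2 i β hs))
  · intro h
    refine ⟨hx, fun i β hi => (tightWord_eq_some_iff hε hε' hb hx i β).1 ?_⟩
    rw [h.eq_of_ne_none (by simp [hi]), hi]

theorem mem_deformedFace_tightWord (hε : 0 < ε) (hε' : ε ≤ 1 / 2) (hb : GrowsFast ε b)
    {x : Fin m → ℝ} (hx : x ∈ deformedCube m ε b) :
    x ∈ deformedFace m ε b (tightWord m ε b x) :=
  (mem_deformedFace_iff hε hε' hb hx _).2 (CubeFace.IsSubface.refl _)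

theorem deformedFace_subset_iff (hε : 0 < ε) (hε' : ε ≤ 1 / 2) (hb : GrowsFast ε b)
    {s t : CubeFace m} : deformedFace m ε b t ⊆ deformedFace m ε b s ↔ t.IsSubface s := by
  refine ⟨fun h i => ?_, deformedFace_mono⟩
  rcases hs : s i with _ | β
  · exact Or.inl rfl
  · right
    by_contra hne
    -- Some vertex of the face `t` has the opposite `i`-th coordinate.
    obtain ⟨x, hx, hxt⟩ := exists_mem_deformedCube_of_signs hε hε' hb
      fun k => (t k).getD (if k = i then !β else true)
    have h1 := (h ⟨hx, fun k γ hk => by simpa [hk] using hxt k⟩).2 i β hs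
    have h2 := (cubeRow_bnot_lt_of_eq hε hε' hb hx h1).ne
    have h3 := hxt i
    rcases ht : t i with _ | γ
    · simp only [ht, Option.getD_none, if_true] at h3
      exact h2 h3
    · have : γ = !β := by
        cases γ <;> cases β <;> simp_all
      simp only [ht, Option.getD_some, this] at h3
      exact h2 h3

/-- Every point of the deformed cube lies in the relative interior of the smallest face that
contains it. -/
theorem exists_sub_smul_mem_deformedFace (hε : 0 < ε) (hε' : ε ≤ 1 / 2) (hb : GrowsFast ε b)
    {x y : Fin m → ℝ} (hx : x ∈ deformedCube m ε b)
    (hy : y ∈ deformedFace m ε b (tightWord m ε b x)) :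
    ∃ δ : ℝ, 0 < δ ∧ x - δ • (y - x) ∈ deformedFace m ε b (tightWord m ε b x) := by
  have hev : ∀ᶠ δ in nhdsWithin (0 : ℝ) (Set.Ioi 0),
      ∀ β i, cubeRow m ε β i (x - δ • (y - x)) ≤ b i := by
    rw [Filter.eventually_all]
    intro β
    rw [Filter.eventually_all]
    intro i
    rcases (mem_deformedCube_iff.1 hx β i).eq_or_lt with h | h
    · have h' := hy.2 i β ((tightWord_eq_some_iff hε hε' hb hx i β).2 h)
      refine Filter.Eventually.of_forall fun δ => ?_
      rw [map_sub, map_smul, map_sub, h, h', sub_self, smul_zero, sub_zero]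
    · have hc : Continuous fun δ : ℝ => cubeRow m ε β i (x - δ • (y - x)) := by
        simp only [map_sub, map_smul, smul_eq_mul]
        fun_prop
      have hl : Filter.Tendsto (fun δ : ℝ => cubeRow m ε β i (x - δ • (y - x))) (nhds 0)
          (nhds (cubeRow m ε β i x)) := by
        simpa using hc.tendsto 0
      filter_upwards [(hl.mono_left nhdsWithin_le_nhds).eventually_lt_const h] with δ hδ
      exact hδ.le
  obtain ⟨δ, h1, h2⟩ := (hev.and self_mem_nhdsWithin).exists
  refine ⟨δ, h2, mem_deformedCube_iff.2 h1, fun i β hi => ?_⟩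
  rw [map_sub, map_smul, map_sub, hy.2 i β hi,
    (tightWord_eq_some_iff hε hε' hb hx i β).1 hi, sub_self, smul_zero, sub_zero]

/-- An extreme subset of a face that contains `x` contains the smallest face that contains `x`. -/
theorem deformedFace_tightWord_subset (hε : 0 < ε) (hε' : ε ≤ 1 / 2) (hb : GrowsFast ε b)
    {s : CubeFace m} {G : Set (Fin m → ℝ)} (hG : IsExtreme ℝ (deformedFace m ε b s) G)
    {x : Fin m → ℝ} (hx : x ∈ G) : deformedFace m ε b (tightWord m ε b x) ⊆ G := by
  intro y hy
  have hxs := hG.subset hx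
  obtain ⟨δ, hδ, h⟩ := exists_sub_smul_mem_deformedFace hε hε' hb hxs.1 hy
  have hsub := deformedFace_mono (ε := ε) (b := b) ((mem_deformedFace_iff hε hε' hb hxs.1 s).1 hxs)
  refine hG.left_mem_of_mem_openSegment (hsub hy) (hsub h) hx ?_
  refine ⟨δ / (1 + δ), 1 / (1 + δ), by positivity, by positivity, by field_simp; ring, ?_⟩
  ext k
  simp only [Pi.add_apply, Pi.smul_apply, Pi.sub_apply, smul_eq_mul]
  field_simp
  ring

/-- The nonempty convex extreme subsets of a face of the deformed cube are the faces given by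
subwords. -/
theorem exists_eq_deformedFace_of_isExtreme (hε : 0 < ε) (hε' : ε ≤ 1 / 2) (hb : GrowsFast ε b)
    {s : CubeFace m} {G : Set (Fin m → ℝ)} (hG : IsExtreme ℝ (deformedFace m ε b s) G)
    (hc : Convex ℝ G) (hne : G.Nonempty) :
    ∃ t : CubeFace m, t.IsSubface s ∧ G = deformedFace m ε b t := by
  -- A point of `G` with as few tight inequalities as possible.
  obtain ⟨_, ⟨x, hx, rfl⟩, hmax⟩ := Set.exists_max_image (tightWord m ε b '' G) CubeFace.dim
    (Set.toFinite _) (hne.image _)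
  have hxs := hG.subset hx
  refine ⟨tightWord m ε b x, (mem_deformedFace_iff hε hε' hb hxs.1 s).1 hxs,
    Set.Subset.antisymm (fun y hy => ?_) (deformedFace_tightWord_subset hε hε' hb hG hx)⟩
  have hys := hG.subset hy
  have hzm : midpoint ℝ x y ∈ G := hc.midpoint_mem hx hy
  have hzo : midpoint ℝ x y ∈ openSegment ℝ x y := midpoint_mem_openSegment x y
  set z := midpoint ℝ x y with hz
  have hzs := hG.subset hzm
  have hzw := mem_deformedFace_tightWord hε hε' hb hzs.1
  have hxz := (isExtreme_deformedFace _).left_mem_of_mem_openSegment hxs.1 hys.1 hzw hzo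
  have hyz := (isExtreme_deformedFace _).left_mem_of_mem_openSegment hys.1 hxs.1 hzw
    (openSegment_symm ℝ x y ▸ hzo)
  have hsub := (mem_deformedFace_iff hε hε' hb hxs.1 _).1 hxz
  have hfree : (tightWord m ε b x).free = (tightWord m ε b z).free :=
    Finset.eq_of_subset_of_card_le hsub.free_subset (hmax _ ⟨z, hzm, rfl⟩)
  have : tightWord m ε b x = tightWord m ε b z := by
    funext i
    by_cases hi : tightWord m ε b z i = none
    · rw [hi, ← CubeFace.mem_free, hfree, CubeFace.mem_free, hi]
    · exact hsub.eq_of_ne_none hi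
  rwa [this]

theorem eq_zero_of_forall_lt_imp {z : Fin m → ℝ} (h : ∀ i, (∀ j < i, z j = 0) → z i = 0) :
    z = 0 := by
  funext i
  induction i using WellFoundedLT.induction with
  | ind i ih => exact h i ih

/-- A vector along the face `s` that vanishes in the free coordinates of `s` is zero. -/
theorem eq_zero_of_cubeRow_eq_zero (hε : 0 < ε) {s : CubeFace m} {z : Fin m → ℝ}
    (h : ∀ i β, s i = some β → cubeRow m ε β i z = 0) (h0 : ∀ i, s i = none → z i = 0) :
    z = 0 := by
  refine eq_zero_of_forall_lt_imp fun i hi => ?_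
  rcases hs : s i with _ | β
  · exact h0 i hs
  · have h1 := h i β hs
    rw [cubeRow_apply, bandRow_congr (y := 0) (by simpa using hi), map_zero, add_zero] at h1
    have h2 : boolSign β ≠ 0 := fun h => by simpa [h] using abs_boolSign β
    simpa [h2, hε.ne'] using h1

theorem affineDim_deformedFace_le (hε : 0 < ε) (s : CubeFace m) :
    affineDim (deformedFace m ε b s) ≤ s.dim := by
  let K : Submodule ℝ (Fin m → ℝ) :=
    { carrier := {z | ∀ i β, s i = some β → cubeRow m ε β i z = 0}
      add_mem' := fun {x y} hx hy i β hi => by rw [map_add, hx i β hi, hy i β hi, add_zero]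
      zero_mem' := fun i β hi => map_zero _
      smul_mem' := fun c x hx i β hi => by rw [map_smul, hx i β hi, smul_zero] }
  have hK : vectorSpan ℝ (deformedFace m ε b s) ≤ K := by
    rw [vectorSpan_def, Submodule.span_le]
    rintro _ ⟨x, hx, y, hy, rfl⟩ i β hi
    change cubeRow m ε β i (x - y) = 0
    rw [map_sub, hx.2 i β hi, hy.2 i β hi, sub_self]
  have hinj : Function.Injective
      ((LinearMap.funLeft ℝ ℝ (Subtype.val : {i // i ∈ s.free} → Fin m)).comp K.subtype) := by
    rw [← LinearMap.ker_eq_bot, LinearMap.ker_eq_bot']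
    intro z hz
    refine Subtype.ext (eq_zero_of_cubeRow_eq_zero hε (s := s) z.2 fun i hi => ?_)
    exact congrFun hz ⟨i, CubeFace.mem_free.2 hi⟩
  calc affineDim (deformedFace m ε b s) ≤ Module.finrank ℝ K := Submodule.finrank_mono hK
    _ ≤ Module.finrank ℝ ({i // i ∈ s.free} → ℝ) :=
      LinearMap.finrank_le_finrank_of_injective hinj
    _ = s.dim := by simp [CubeFace.dim]

theorem subsingleton_deformedFace (hε : 0 < ε) {s : CubeFace m} (hs : s.dim = 0) :
    (deformedFace m ε b s).Subsingleton := by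
  intro x hx y hy
  rw [← sub_eq_zero]
  refine eq_zero_of_cubeRow_eq_zero hε (s := s) (fun i β hi => ?_)
    fun i hi => absurd hi (CubeFace.dim_eq_zero.1 hs i)
  rw [map_sub, hx.2 i β hi, hy.2 i β hi, sub_self]

theorem isCompact_deformedFace (hε : 0 < ε) (hε' : ε ≤ 1 / 2) (hb : GrowsFast ε b)
    (s : CubeFace m) : IsCompact (deformedFace m ε b s) := by
  refine Metric.isCompact_of_isClosed_isBounded ?_ ?_
  · have : deformedFace m ε b s = (⋂ β, ⋂ i, {x | cubeRow m ε β i x ≤ b i}) ∩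
        ⋂ i, ⋂ β, ⋂ (_ : s i = some β), {x | cubeRow m ε β i x = b i} := by
      ext x
      simp only [deformedFace, mem_deformedCube_iff, Set.mem_ofPred_eq, Set.mem_inter_iff,
        Set.mem_iInter]
    rw [this]
    have hc : ∀ β i, Continuous (cubeRow m ε β i) := fun β i =>
      LinearMap.continuous_of_finiteDimensional _
    exact (isClosed_iInter fun β => isClosed_iInter fun i =>
      isClosed_le (hc β i) continuous_const).inter
      (isClosed_iInter fun i => isClosed_iInter fun β => isClosed_iInter fun _ =>
        isClosed_eq (hc β i) continuous_const)
  · rw [isBounded_iff_forall_norm_le]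
    refine ⟨∑ k, 2 * b k / ε, fun x hx => (pi_norm_le_iff_of_nonneg ?_).2 fun k => ?_⟩
    · exact Finset.sum_nonneg fun k _ => by have := hb.1 k; positivity
    · exact (abs_le_of_mem_deformedCube hε hε' hb hx.1 k).trans
        (Finset.single_le_sum (f := fun k => 2 * b k / ε)
          (fun k _ => by have := hb.1 k; positivity) (Finset.mem_univ k))

/-- By the Krein-Milman theorem, a face of the deformed cube is the convex hull of its vertices. -/
theorem isPolytope_deformedFace (hε : 0 < ε) (hε' : ε ≤ 1 / 2) (hb : GrowsFast ε b)
    (s : CubeFace m) : IsPolytope (deformedFace m ε b s) := by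
  have hfin : (Set.extremePoints ℝ (deformedFace m ε b s)).Finite := by
    refine Set.Finite.subset (s := ⋃ t ∈ {t : CubeFace m | t.dim = 0}, deformedFace m ε b t)
      ((Set.toFinite _).biUnion fun t ht => (subsingleton_deformedFace hε ht).finite) ?_
    intro x hx
    have hxs := hx.1
    have hsing : ∀ y ∈ deformedFace m ε b (tightWord m ε b x), y = x := fun y hy =>
      deformedFace_tightWord_subset hε hε' hb (isExtreme_singleton.2 hx) (Set.mem_singleton x) hy
    refine Set.mem_biUnion (x := tightWord m ε b x) ?_ (mem_deformedFace_tightWord hε hε' hb hxs.1)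
    refine CubeFace.dim_eq_zero.2 fun i hi => ?_
    obtain ⟨y, hy⟩ := nonempty_deformedFace hε hε' hb
      (Function.update (tightWord m ε b x) i (some true))
    have hsub : CubeFace.IsSubface (Function.update (tightWord m ε b x) i (some true))
        (tightWord m ε b x) := fun k => by
      by_cases hk : k = i
      · subst hk; exact Or.inl hi
      · right; simp [hk]
    have hyx := hsing y (deformedFace_mono hsub hy)
    have := (tightWord_eq_some_iff hε hε' hb hxs.1 i true).2
      (hyx ▸ hy.2 i true (by simp))
    rw [hi] at this
    exact absurd this (by simp)
  refine ⟨_, hfin, ?_⟩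
  have := closure_convexHull_extremePoints (isCompact_deformedFace hε hε' hb s)
    (convex_deformedFace s)
  rw [(hfin.isClosed_convexHull ℝ).closure_eq] at this
  exact this.symm

theorem deformedFace_inter (hε : 0 < ε) (hε' : ε ≤ 1 / 2) (hb : GrowsFast ε b)
    {s t : CubeFace m} (h : (deformedFace m ε b s ∩ deformedFace m ε b t).Nonempty) :
    ∃ r : CubeFace m, r.IsSubface s ∧ r.IsSubface t ∧
      deformedFace m ε b s ∩ deformedFace m ε b t = deformedFace m ε b r := by
  have hext : IsExtreme ℝ (deformedFace m ε b s) (deformedFace m ε b s ∩ deformedFace m ε b t) := by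
    refine ⟨Set.inter_subset_left, fun x hx y hy z hz hxy => ⟨hx, ?_⟩⟩
    exact (isExtreme_deformedFace t).left_mem_of_mem_openSegment hx.1 hy.1 hz.2 hxy
  obtain ⟨r, hr, heq⟩ := exists_eq_deformedFace_of_isExtreme hε hε' hb hext
    ((convex_deformedFace s).inter (convex_deformedFace t)) h
  exact ⟨r, hr, (deformedFace_subset_iff hε hε' hb).1 (heq ▸ Set.inter_subset_right), heq⟩

end Cube

/-! ### Faces and facets of polytopes -/

section PolytopeFaces

variable {E F : Type*} [AddCommGroup E] [Module ℝ E] [AddCommGroup F] [Module ℝ F]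

theorem IsPolytope.convex {P : Set E} (hP : IsPolytope P) : Convex ℝ P := by
  obtain ⟨T, -, rfl⟩ := hP
  exact convex_convexHull ℝ T

theorem IsFace.subset {P G : Set E} (h : IsFace P G) : G ⊆ P := by
  obtain ⟨a, c, -, rfl⟩ := h
  exact fun x hx => hx.1

theorem IsFace.convex {P G : Set E} (hP : Convex ℝ P) (h : IsFace P G) : Convex ℝ G := by
  obtain ⟨a, c, -, rfl⟩ := h
  intro x hx y hy p q hp hq hpq
  refine ⟨hP hx.1 hy.1 hp hq hpq, ?_⟩
  rw [map_add, map_smul, map_smul, hx.2, hy.2, ← add_smul, hpq, one_smul]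

theorem IsFace.isExtreme {P G : Set E} (h : IsFace P G) : IsExtreme ℝ P G := by
  obtain ⟨a, c, hv, rfl⟩ := h
  refine ⟨fun x hx => hx.1, fun x hx y hy z hz hxy => ⟨hx, ?_⟩⟩
  obtain ⟨p, q, hp, hq, hpq, rfl⟩ := hxy
  have h1 := hz.2
  rw [map_add, map_smul, map_smul, smul_eq_mul, smul_eq_mul] at h1
  have h3 := mul_le_mul_of_nonneg_left (hv y hy) hq.le
  refine le_antisymm (hv x hx) (le_of_mul_le_mul_left ?_ hp)
  have : c = p * c + q * c := by rw [← add_mul, hpq, one_mul]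
  linarith

/-- A linear functional that is constant on a set vanishes on its vector span. -/
theorem vectorSpan_le_ker {S : Set E} {a : Module.Dual ℝ E} {c : ℝ} (h : ∀ x ∈ S, a x = c) :
    vectorSpan ℝ S ≤ LinearMap.ker a := by
  rw [vectorSpan_def, Submodule.span_le]
  rintro _ ⟨x, hx, y, hy, rfl⟩
  change a (x - y) = 0
  rw [map_sub, h x hx, h y hy, sub_self]

theorem sub_mem_vectorSpan {S : Set E} {x y : E} (hx : x ∈ S) (hy : y ∈ S) :
    x - y ∈ vectorSpan ℝ S :=
  vsub_mem_vectorSpan ℝ hx hy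

theorem affineDim_mono [FiniteDimensional ℝ E] {S T : Set E} (h : S ⊆ T) :
    affineDim S ≤ affineDim T :=
  Submodule.finrank_mono (vectorSpan_mono ℝ h)

theorem affineDim_image_le [FiniteDimensional ℝ E] (f : E →ᵃ[ℝ] F) (S : Set E) :
    affineDim (f '' S) ≤ affineDim S := by
  rw [affineDim, ← AffineMap.map_vectorSpan]
  exact Submodule.finrank_map_le _ _

theorem affineDim_lt_of_isFace [FiniteDimensional ℝ E] {P G : Set E} (h : IsFace P G)
    (hne : G.Nonempty) (hGP : G ≠ P) : affineDim G < affineDim P := by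
  have hsub := h.subset
  obtain ⟨a, c, hv, rfl⟩ := h
  obtain ⟨g, hg⟩ := hne
  obtain ⟨x, hx, hxG⟩ := Set.not_subset.1 fun h => hGP (hsub.antisymm h)
  refine Submodule.finrank_lt_finrank_of_lt (lt_of_le_of_ne (vectorSpan_mono ℝ hsub) fun heq => ?_)
  have h1 : x - g ∈ LinearMap.ker a :=
    vectorSpan_le_ker (fun z hz => hz.2) (heq ▸ sub_mem_vectorSpan hx hg.1)
  rw [LinearMap.mem_ker, map_sub, hg.2, sub_eq_zero] at h1
  exact hxG ⟨hx, h1⟩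

theorem isValidOn_convexHull {T : Set E} {a : Module.Dual ℝ E} {c : ℝ} (h : ∀ x ∈ T, a x ≤ c) :
    IsValidOn (convexHull ℝ T) a c :=
  convexHull_min (t := {x | a x ≤ c}) h (convex_halfSpace_le a.isLinear c)

theorem eq_zero_of_constant_of_vectorSpan_eq_top {P : Set E} (hP : vectorSpan ℝ P = ⊤)
    {k : Module.Dual ℝ E} {d : ℝ} (h : ∀ x ∈ P, k x = d) : k = 0 := by
  have := vectorSpan_le_ker h
  rw [hP, top_le_iff, LinearMap.ker_eq_top] at this
  exact this

theorem vectorSpan_eq_top_of_affineDim [FiniteDimensional ℝ E] {P : Set E}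
    (hP : affineDim P = Module.finrank ℝ E) : vectorSpan ℝ P = ⊤ :=
  Submodule.eq_top_of_finrank_eq hP

/-- Rotating a supporting hyperplane of a polytope about a proper face `G` until it hits another
vertex: `g x = cg` is the hyperplane, and `h` is constant on `G`. -/
theorem exists_rotated_isValidOn {T : Set E} (hT : T.Finite) {g h : Module.Dual ℝ E} {cg ch : ℝ}
    (hg : IsValidOn (convexHull ℝ T) g cg) (hh : ∀ x ∈ faceOf (convexHull ℝ T) g cg, h x = ch)
    (hne : faceOf (convexHull ℝ T) g cg ≠ convexHull ℝ T) :
    ∃ ρ : ℝ, IsValidOn (convexHull ℝ T) (h + ρ • g) (ch + ρ * cg) ∧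
      ∃ v ∈ convexHull ℝ T, g v < cg ∧ (h + ρ • g) v = ch + ρ * cg := by
  have hTne : (T \ faceOf (convexHull ℝ T) g cg).Nonempty := by
    rw [Set.sdiff_nonempty]
    intro hsub
    exact hne (Set.Subset.antisymm (fun x hx => hx.1) (convexHull_min hsub
      (IsFace.convex (convex_convexHull ℝ T) ⟨g, cg, hg, rfl⟩)))
  have hpos : ∀ v ∈ T \ faceOf (convexHull ℝ T) g cg, 0 < cg - g v := fun v hv => by
    have h1 := subset_convexHull ℝ T hv.1
    rw [sub_pos]
    exact lt_of_le_of_ne (hg v h1) fun h => hv.2 ⟨h1, h⟩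
  obtain ⟨v, hv, hmax⟩ := Set.exists_max_image (T \ faceOf (convexHull ℝ T) g cg)
    (fun v => (h v - ch) / (cg - g v)) (hT.subset Set.sdiff_subset) hTne
  refine ⟨(h v - ch) / (cg - g v), isValidOn_convexHull fun x hx => ?_, v,
    subset_convexHull ℝ T hv.1, sub_pos.1 (hpos v hv), ?_⟩
  · rw [LinearMap.add_apply, LinearMap.smul_apply, smul_eq_mul]
    by_cases hxG : x ∈ faceOf (convexHull ℝ T) g cg
    · rw [hh x hxG, hxG.2]
    · have h1 := hmax x ⟨hx, hxG⟩
      rw [div_le_iff₀ (hpos x ⟨hx, hxG⟩)] at h1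
      linarith
  · rw [LinearMap.add_apply, LinearMap.smul_apply, smul_eq_mul]
    have := (hpos v hv).ne'
    field_simp
    ring

/-- A face of codimension two of a full-dimensional polytope lies in at least two facets. -/
theorem exists_isFacet_ne [FiniteDimensional ℝ E] {P G : Set E} (hP : IsPolytope P)
    (hdim : affineDim P = Module.finrank ℝ E) (hG : IsFace P G) (hGne : G.Nonempty)
    (hcodim : affineDim G + 2 = affineDim P) (H₀ : Set E) :
    ∃ (k : Module.Dual ℝ E) (d : ℝ), IsValidOn P k d ∧ (∀ x ∈ G, k x = d) ∧
      IsFacet P (faceOf P k d) ∧ faceOf P k d ≠ H₀ := by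
  have htop := vectorSpan_eq_top_of_affineDim hdim
  have hGP : G ≠ P := fun h => by rw [h] at hcodim; omega
  obtain ⟨T, hT, rfl⟩ := hP
  obtain ⟨g, cg, hg, rfl⟩ := hG
  set P := convexHull ℝ T
  set G := faceOf P g cg with hGdef
  obtain ⟨x₀, hx₀⟩ := hGne
  -- Two independent functionals are constant on `G`, as `G` has codimension two.
  obtain ⟨h, hhW, hhg⟩ : ∃ h ∈ (vectorSpan ℝ G).dualAnnihilator, h ∉ Submodule.span ℝ {g} := by
    by_contra! hcon
    have h1 : Module.finrank ℝ (vectorSpan ℝ G).dualAnnihilator ≤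
        Module.finrank ℝ (Submodule.span ℝ {g}) := Submodule.finrank_mono hcon
    have h2 := finrank_span_le_card (R := ℝ) {g}
    have h3 := Subspace.finrank_add_finrank_dualAnnihilator_eq (vectorSpan ℝ G)
    simp only [Set.toFinset_singleton, Finset.card_singleton] at h2
    rw [← hdim, ← hcodim] at h3
    change affineDim G + _ = _ at h3
    omega
  have hh : ∀ x ∈ G, h x = h x₀ := fun x hx => by
    have := (Submodule.mem_dualAnnihilator h).1 hhW _ (sub_mem_vectorSpan hx hx₀)
    rwa [map_sub, sub_eq_zero] at this
  have hfacet : ∀ (k : Module.Dual ℝ E) (d : ℝ), IsValidOn P k d → (∀ x ∈ G, k x = d) → k ≠ 0 →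
      (∃ v ∈ P, g v < cg ∧ k v = d) → IsFacet P (faceOf P k d) := by
    rintro k d hk hkG hk0 ⟨v, hvP, hvg, hvk⟩
    have hkne : (faceOf P k d).Nonempty := ⟨v, hvP, hvk⟩
    refine ⟨⟨k, d, hk, rfl⟩, hkne, ?_⟩
    have h1 : affineDim (faceOf P k d) < affineDim P := by
      refine affineDim_lt_of_isFace ⟨k, d, hk, rfl⟩ hkne fun heq => hk0 ?_
      refine eq_zero_of_constant_of_vectorSpan_eq_top (d := d) htop fun x hx => ?_
      rw [← heq] at hx
      exact hx.2
    have h2 : affineDim G < affineDim (faceOf P k d) := by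
      refine affineDim_lt_of_isFace ⟨g, cg, fun x hx => hg x hx.1, ?_⟩ ⟨x₀, hx₀⟩ fun heq => ?_
      · ext x
        exact ⟨fun hx => ⟨⟨hx.1, hkG x hx⟩, hx.2⟩, fun hx => ⟨hx.1.1, hx.2⟩⟩
      · have : v ∈ G := by rw [heq]; exact ⟨hvP, hvk⟩
        exact hvg.ne this.2
    omega
  have hind : ∀ ρ : ℝ, h + ρ • g ≠ 0 := fun ρ h0 => hhg
    (Submodule.mem_span_singleton.2
      ⟨-ρ, by rw [neg_smul, eq_comm]; exact eq_neg_of_add_eq_zero_left h0⟩)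
  have hind' : ∀ ρ : ℝ, -h + ρ • g ≠ 0 := fun ρ h0 => hhg
    (Submodule.mem_span_singleton.2 ⟨ρ, by rw [neg_add_eq_zero] at h0; exact h0.symm⟩)
  obtain ⟨ρ₁, hv₁, v₁, hvP₁, hvg₁, hvk₁⟩ := exists_rotated_isValidOn hT hg hh hGP
  obtain ⟨ρ₂, hv₂, v₂, hvP₂, hvg₂, hvk₂⟩ :=
    exists_rotated_isValidOn (h := -h) (ch := -h x₀) hT hg
      (fun x hx => by rw [LinearMap.neg_apply, hh x hx]) hGP
  have hc₁ : ∀ x ∈ G, (h + ρ₁ • g) x = h x₀ + ρ₁ * cg := fun x hx => by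
    rw [LinearMap.add_apply, LinearMap.smul_apply, smul_eq_mul, hh x hx, hx.2]
  have hc₂ : ∀ x ∈ G, (-h + ρ₂ • g) x = -h x₀ + ρ₂ * cg := fun x hx => by
    rw [LinearMap.add_apply, LinearMap.smul_apply, smul_eq_mul, LinearMap.neg_apply, hh x hx, hx.2]
  by_cases hH : faceOf P (h + ρ₁ • g) (h x₀ + ρ₁ * cg) = H₀
  · refine ⟨_, _, hv₂, hc₂, hfacet _ _ hv₂ hc₂ (hind' ρ₂) ⟨v₂, hvP₂, hvg₂, hvk₂⟩, fun hH' => ?_⟩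
    -- If both facets coincide, then the two rotations are opposite and `P` lies in a hyperplane.
    have hmem : v₁ ∈ faceOf P (-h + ρ₂ • g) (-h x₀ + ρ₂ * cg) := by
      rw [hH', ← hH]; exact ⟨hvP₁, hvk₁⟩
    have h2 := hmem.2
    simp only [LinearMap.add_apply, LinearMap.smul_apply, smul_eq_mul, LinearMap.neg_apply]
      at h2 hvk₁
    have hρ : ρ₂ = -ρ₁ := by
      have : (ρ₁ + ρ₂) * (cg - g v₁) = 0 := by linarith
      rcases mul_eq_zero.1 this with h | h <;> linarith
    refine hind ρ₁ (eq_zero_of_constant_of_vectorSpan_eq_top (d := h x₀ + ρ₁ * cg) htop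
      fun x hx => ?_)
    have h3 := hv₁ x hx
    have h4 := hv₂ x hx
    rw [hρ] at h4
    simp only [LinearMap.add_apply, LinearMap.smul_apply, smul_eq_mul, LinearMap.neg_apply]
      at h3 h4 ⊢
    linarith
  · exact ⟨_, _, hv₁, hc₁, hfacet _ _ hv₁ hc₁ (hind ρ₁) ⟨v₁, hvP₁, hvg₁, hvk₁⟩, hH⟩

end PolytopeFaces

/-! ### Maps that preserve segments -/

section PreservesSegments

variable {E F V : Type*} [AddCommGroup E] [Module ℝ E] [AddCommGroup F] [Module ℝ F]
  [AddCommGroup V] [Module ℝ V]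

/-- The map `ψ` maps each open segment between points of `D` onto the open segment between the
images. Affine maps and central projections have this property. -/
def PreservesSegments (D : Set E) (ψ : E → F) : Prop :=
  ∀ u ∈ D, ∀ v ∈ D, ψ '' openSegment ℝ u v = openSegment ℝ (ψ u) (ψ v)

theorem PreservesSegments.mono {C D : Set E} {ψ : E → F} (h : PreservesSegments D ψ)
    (hCD : C ⊆ D) : PreservesSegments C ψ :=
  fun u hu v hv => h u (hCD hu) v (hCD hv)

theorem PreservesSegments.comp {D : Set E} {C : Set F} {ψ : E → F} {χ : F → V}
    (hχ : PreservesSegments C χ) (hψ : PreservesSegments D ψ) (hm : Set.MapsTo ψ D C) :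
    PreservesSegments D (χ ∘ ψ) := fun u hu v hv => by
  rw [Set.image_comp, hψ u hu v hv, hχ _ (hm hu) _ (hm hv)]
  rfl

theorem AffineMap.preservesSegments (f : E →ᵃ[ℝ] F) (D : Set E) : PreservesSegments D f :=
  fun u _ v _ => image_openSegment ℝ f u v

theorem PreservesSegments.mem_openSegment {D : Set E} {ψ : E → F} (h : PreservesSegments D ψ)
    {u v x : E} (hu : u ∈ D) (hv : v ∈ D) (hx : x ∈ openSegment ℝ u v) :
    ψ x ∈ openSegment ℝ (ψ u) (ψ v) :=
  h u hu v hv ▸ Set.mem_image_of_mem ψ hx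

theorem PreservesSegments.convex_image {D : Set E} {ψ : E → F} (h : PreservesSegments D ψ)
    (hD : Convex ℝ D) : Convex ℝ (ψ '' D) := by
  rw [convex_iff_openSegment_subset]
  rintro _ ⟨x, hx, rfl⟩ _ ⟨y, hy, rfl⟩
  rw [← h x hx y hy]
  exact Set.image_mono (hD.openSegment_subset hx hy)

theorem PreservesSegments.convex_inter_preimage {D : Set E} {ψ : E → F}
    (h : PreservesSegments D ψ) (hD : Convex ℝ D) {C : Set F} (hC : Convex ℝ C) :
    Convex ℝ {x ∈ D | ψ x ∈ C} := by
  rw [convex_iff_openSegment_subset]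
  rintro x ⟨hx, hxC⟩ y ⟨hy, hyC⟩ z hz
  exact ⟨hD.openSegment_subset hx hy hz,
    hC.openSegment_subset hxC hyC (h.mem_openSegment hx hy hz)⟩

theorem PreservesSegments.isPolytope_image {P : Set E} {ψ : E → F} (h : PreservesSegments P ψ)
    (hP : IsPolytope P) : IsPolytope (ψ '' P) := by
  have hc := hP.convex
  obtain ⟨T, hT, rfl⟩ := hP
  refine ⟨ψ '' T, hT.image ψ, Set.Subset.antisymm ?_ ?_⟩
  · rintro _ ⟨x, hx, rfl⟩
    have := convexHull_min (t := {x ∈ convexHull ℝ T | ψ x ∈ convexHull ℝ (ψ '' T)})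
      (fun x hx => ⟨subset_convexHull ℝ T hx,
      subset_convexHull ℝ _ (Set.mem_image_of_mem ψ hx)⟩)
      (h.convex_inter_preimage hc (convex_convexHull ℝ (ψ '' T)))
    exact (this hx).2
  · exact convexHull_min (Set.image_mono (subset_convexHull ℝ T)) (h.convex_image hc)

theorem PreservesSegments.isExtreme_preimage {D : Set E} {ψ : E → F} (h : PreservesSegments D ψ)
    {G : Set F} (hG : IsExtreme ℝ (ψ '' D) G) : IsExtreme ℝ D {x ∈ D | ψ x ∈ G} :=
  ⟨fun _ hx => hx.1, fun _ hx _ hy _ hz hxy => ⟨hx, hG.left_mem_of_mem_openSegment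
    (Set.mem_image_of_mem ψ hx) (Set.mem_image_of_mem ψ hy) hz.2 (h.mem_openSegment hx hy hxy)⟩⟩

end PreservesSegments

/-! ### Realizations by images of the faces of the deformed cube -/

/-- If a segment-preserving map of the deformed cube is injective on the union of the faces given by
`Q` and makes subfaces into faces without raising dimensions, then the images of the faces realize
`Q`. The faces of an image have no choice but to come from subwords, as their preimages are extreme
and convex; and the dimensions cannot drop, as they strictly increase along chains of faces. -/
theorem isGeometricRealization_image {m : ℕ} {ε : ℝ} {b : Fin m → ℝ} (hε : 0 < ε)
    (hε' : ε ≤ 1 / 2) (hb : GrowsFast ε b) {V : Type*} [AddCommGroup V] [Module ℝ V]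
    [FiniteDimensional ℝ V] {Q : Set (CubeFace m)}
    (hQ : ∀ s ∈ Q, ∀ t : CubeFace m, t.IsSubface s → t ∈ Q)
    {ψ : (Fin m → ℝ) → V} (hψ : PreservesSegments (deformedCube m ε b) ψ)
    (hinj : ∀ s ∈ Q, ∀ t ∈ Q, ∀ x ∈ deformedFace m ε b s, ∀ y ∈ deformedFace m ε b t,
      ψ x = ψ y → x = y)
    (hface : ∀ s ∈ Q, ∀ t ∈ Q, t.IsSubface s →
      IsFace (ψ '' deformedFace m ε b s) (ψ '' deformedFace m ε b t))
    (hdim : ∀ s ∈ Q, affineDim (ψ '' deformedFace m ε b s) ≤ s.dim) :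
    IsGeometricRealization Q fun s => ψ '' deformedFace m ε b s := by
  have hψs : ∀ s, PreservesSegments (deformedFace m ε b s) ψ := fun s =>
    hψ.mono (deformedFace_subset_cube s)
  have hsub : ∀ s ∈ Q, ∀ t ∈ Q,
      ψ '' deformedFace m ε b t ⊆ ψ '' deformedFace m ε b s ↔ t.IsSubface s := by
    intro s hs t ht
    rw [← deformedFace_subset_iff hε hε' hb]
    refine ⟨fun h x hx => ?_, Set.image_mono⟩
    obtain ⟨y, hy, hyx⟩ := h (Set.mem_image_of_mem ψ hx)
    rwa [← hinj s hs t ht y hy x hx hyx]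
  have hne : ∀ s, (ψ '' deformedFace m ε b s).Nonempty := fun s =>
    (nonempty_deformedFace hε hε' hb s).image ψ
  refine ⟨fun s _ => (hψs s).isPolytope_image (isPolytope_deformedFace hε hε' hb s),
    fun s _ => hne s, fun s hs => le_antisymm (hdim s hs) ?_, ?_, hsub, ?_⟩
  · -- The dimension drops strictly when a free coordinate is fixed.
    have key : ∀ d, ∀ s ∈ Q, s.dim = d → d ≤ affineDim (ψ '' deformedFace m ε b s) := by
      intro d
      induction d with
      | zero => exact fun _ _ _ => Nat.zero_le _
      | succ d ih =>
        intro s hs hd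
        obtain ⟨i, hi⟩ : s.free.Nonempty := by
          rw [← Finset.card_pos]
          change 0 < s.dim
          omega
        have hi' := CubeFace.mem_free.1 hi
        have hts : CubeFace.IsSubface (Function.update s i (some true)) s := fun k => by
          by_cases hk : k = i
          · subst hk; exact Or.inl hi'
          · right; simp [hk]
        have htd : CubeFace.dim (Function.update s i (some true)) = d := by
          have : CubeFace.free (Function.update s i (some true)) = s.free.erase i := by
            ext k
            rw [CubeFace.mem_free, Finset.mem_erase, CubeFace.mem_free]
            by_cases hk : k = i
            · subst hk; simp
            · simp [hk]
          rw [CubeFace.dim, this, Finset.card_erase_of_mem hi]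
          exact Nat.pred_eq_of_eq_succ hd
        have htQ := hQ s hs _ hts
        refine (ih _ htQ htd).trans_lt (affineDim_lt_of_isFace (hface s hs _ htQ hts) (hne _) ?_)
        intro heq
        have := (hsub _ htQ s hs).1 heq.ge i
        simp [hi'] at this
    exact key _ s hs rfl
  · intro s hs G
    constructor
    · rintro ⟨hGne, hG⟩
      have hc : Convex ℝ {x ∈ deformedFace m ε b s | ψ x ∈ G} :=
        (hψs s).convex_inter_preimage (convex_deformedFace s)
          (hG.convex ((hψs s).convex_image (convex_deformedFace s)))
      have hne' : {x ∈ deformedFace m ε b s | ψ x ∈ G}.Nonempty := by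
        obtain ⟨y, hy⟩ := hGne
        obtain ⟨x, hx, rfl⟩ := hG.subset hy
        exact ⟨x, hx, hy⟩
      obtain ⟨t, hts, heq⟩ := exists_eq_deformedFace_of_isExtreme hε hε' hb
        ((hψs s).isExtreme_preimage hG.isExtreme) hc hne'
      refine ⟨t, hQ s hs t hts, hts, ?_⟩
      rw [← heq]
      ext y
      constructor
      · rintro ⟨x, hx, rfl⟩
        exact hx.2
      · intro hy
        obtain ⟨x, hx, rfl⟩ := hG.subset hy
        exact ⟨x, ⟨hx, hy⟩, rfl⟩
    · rintro ⟨t, ht, hts, rfl⟩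
      exact ⟨hne t, hface s hs t ht hts⟩
  · rintro s hs t ht ⟨_, ⟨x, hx, rfl⟩, ⟨y, hy, hyx⟩⟩
    have himg : ψ '' deformedFace m ε b s ∩ ψ '' deformedFace m ε b t =
        ψ '' (deformedFace m ε b s ∩ deformedFace m ε b t) := by
      refine Set.Subset.antisymm ?_ (Set.image_inter_subset _ _ _)
      rintro _ ⟨⟨x, hx, rfl⟩, ⟨y, hy, hyx⟩⟩
      exact ⟨x, ⟨hx, hinj t ht s hs y hy x hx hyx ▸ hy⟩, rfl⟩
    obtain ⟨r, hrs, hrt, heq⟩ := deformedFace_inter hε hε' hb (s := s) (t := t)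
      ⟨x, hx, hinj t ht s hs y hy x hx hyx ▸ hy⟩
    exact ⟨r, hQ s hs r hrs, hrs, hrt, by rw [himg, heq]⟩

/-! ### Positive dependences of the rows -/

open Matrix in
/-- A family of vectors that spans and has a strictly positive linear dependence keeps both
properties under small perturbations. With `N = A + ε B`, the perturbed dependence is
`det (Aᵀ N) • w - ((w N) adj (Aᵀ N)) Aᵀ`, which is polynomial in `ε`. -/
theorem eventually_exists_pos_vecMul_eq_zero {I J : Type*} [Fintype I] [Fintype J] [DecidableEq J]
    (A B : Matrix I J ℝ) (w : I → ℝ) (hw : ∀ i, 0 < w i) (hwA : w ᵥ* A = 0)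
    (hA : ∀ z, A *ᵥ z = 0 → z = 0) :
    ∀ᶠ ε in nhds (0 : ℝ), (∃ w' : I → ℝ, (∀ i, 0 < w' i) ∧ w' ᵥ* (A + ε • B) = 0) ∧
      ∀ z, (A + ε • B) *ᵥ z = 0 → z = 0 := by
  let N : ℝ → Matrix I J ℝ := fun ε => A + ε • B
  have hN : Continuous N := by fun_prop
  have hN0 : N 0 = A := by simp [N]
  have hdet0 : 0 < (Aᵀ * A).det := by
    have : (Aᵀ * A).PosDef := by
      have := Matrix.PosDef.conjTranspose_mul_self A (fun x y (hxy : A *ᵥ x = A *ᵥ y) => by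
        rw [← sub_eq_zero, ← Matrix.mulVec_sub] at hxy
        exact sub_eq_zero.1 (hA _ hxy))
      rwa [Matrix.conjTranspose_eq_transpose_of_trivial] at this
    exact this.det_pos
  have hG : Continuous fun ε => Aᵀ * N ε := by fun_prop
  have hdet : ∀ᶠ ε in nhds (0 : ℝ), 0 < (Aᵀ * N ε).det := by
    have := hG.matrix_det.tendsto 0
    simp only [hN0] at this
    exact this.eventually_const_lt hdet0
  let W : ℝ → I → ℝ := fun ε =>
    (Aᵀ * N ε).det • w - ((w ᵥ* N ε) ᵥ* (Aᵀ * N ε).adjugate) ᵥ* Aᵀ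
  have hW : Continuous W := by
    have h1 := hG.matrix_det
    have h2 := hG.matrix_adjugate
    exact (h1.smul continuous_const).sub
      (((continuous_const.matrix_vecMul hN).matrix_vecMul h2).matrix_vecMul continuous_const)
  have hW0 : W 0 = (Aᵀ * A).det • w := by
    change (Aᵀ * N 0).det • w - ((w ᵥ* N 0) ᵥ* (Aᵀ * N 0).adjugate) ᵥ* Aᵀ = _
    rw [hN0, hwA, Matrix.zero_vecMul, Matrix.zero_vecMul, sub_zero]
  have hpos : ∀ᶠ ε in nhds (0 : ℝ), ∀ i, 0 < W ε i := by
    rw [Filter.eventually_all]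
    intro i
    have h1 := ((continuous_apply i).comp hW).tendsto 0
    simp only [Function.comp_apply, hW0] at h1
    refine h1.eventually_const_lt ?_
    simpa using mul_pos hdet0 (hw i)
  filter_upwards [hdet, hpos] with ε h1 h2
  refine ⟨⟨W ε, h2, ?_⟩, fun z hz => ?_⟩
  · change W ε ᵥ* N ε = 0
    rw [Matrix.sub_vecMul, Matrix.smul_vecMul, Matrix.vecMul_vecMul _ Aᵀ,
      Matrix.vecMul_vecMul _ _ (Aᵀ * N ε), Matrix.adjugate_mul, Matrix.vecMul_smul,
      Matrix.vecMul_one, sub_self]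
  · refine Matrix.eq_zero_of_mulVec_eq_zero h1.ne' ?_
    rw [← Matrix.mulVec_mulVec]
    change Aᵀ *ᵥ (A + ε • B) *ᵥ z = 0
    rw [hz, Matrix.mulVec_zero]

/-- Quadratic polynomials in `2 ^ k`, divided by `2 ^ k`, satisfy the linear recurrence given by the
columns of the band matrix: the characteristic polynomial `2 - 7 t + 7 t² - 2 t³` has the roots `1`,
`2` and `1 / 2`. -/
theorem band_recurrence (c p q : ℝ) (k : ℕ) :
    2 * (c * (2 ^ (k + 1) - p) * (2 ^ (k + 1) - q) / 2 ^ (k + 1))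
      - 7 * (c * (2 ^ (k + 2) - p) * (2 ^ (k + 2) - q) / 2 ^ (k + 2))
      + 7 * (c * (2 ^ (k + 3) - p) * (2 ^ (k + 3) - q) / 2 ^ (k + 3))
      - 2 * (c * (2 ^ (k + 4) - p) * (2 ^ (k + 4) - q) / 2 ^ (k + 4)) = 0 := by
  have : (2 : ℝ) ^ k ≠ 0 := by positivity
  simp only [pow_add]
  field_simp
  ring

/-- Gale's evenness condition for a polygon: for each face of the polygon, some function on the
indices that satisfies the recurrence is zero on the face and positive elsewhere. -/
theorem exists_band_dependence {n : ℕ} {σ : Finset (Fin (n + 3))}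
    (hσ : σ ∈ polygonComplex (n + 3)) :
    ∃ W : ℕ → ℝ, (∀ k, 2 * W (k + 1) - 7 * W (k + 2) + 7 * W (k + 3) - 2 * W (k + 4) = 0) ∧
      (∀ i ∈ σ, W (i : ℕ) = 0) ∧ ∀ i ∉ σ, 0 < W (i : ℕ) := by
  obtain ⟨i, hi⟩ := mem_polygonComplex_iff.1 hσ
  by_cases hσ2 : σ = {i, i + 1}
  · subst hσ2
    by_cases hlast : i = Fin.last (n + 2)
    · -- The edge that joins the last vertex and the first one.
      subst hlast
      refine ⟨fun k => (-1) * (2 ^ k - 1) * (2 ^ k - 2 ^ (n + 2)) / 2 ^ k,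
        fun k => band_recurrence _ _ _ k, ?_, ?_⟩
      · intro j hj
        rw [Finset.mem_insert, Finset.mem_singleton, Fin.last_add_one] at hj
        rcases hj with rfl | rfl <;> simp
      · intro j hj
        rw [Finset.mem_insert, Finset.mem_singleton, Fin.last_add_one, not_or] at hj
        have h1 : (2 : ℝ) ^ (j : ℕ) < 2 ^ (n + 2) := by
          refine pow_lt_pow_right₀ (by norm_num) ?_
          have := j.2
          have : (j : ℕ) ≠ n + 2 := fun h => hj.1 (Fin.ext h)
          omega
        have h2 : (1 : ℝ) < 2 ^ (j : ℕ) :=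
          one_lt_pow₀ (by norm_num) fun h => hj.2 (Fin.ext h)
        refine div_pos ?_ (by positivity)
        rw [mul_assoc, neg_one_mul, neg_pos]
        exact mul_neg_of_pos_of_neg (by linarith) (by linarith)
    · have hi1 : ((i + 1 : Fin (n + 3)) : ℕ) = i + 1 :=
        Fin.val_add_one_of_lt (Fin.lt_last_iff_ne_last.2 hlast)
      refine ⟨fun k => 1 * (2 ^ k - 2 ^ (i : ℕ)) * (2 ^ k - 2 ^ ((i : ℕ) + 1)) / 2 ^ k,
        fun k => band_recurrence _ _ _ k, ?_, ?_⟩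
      · intro j hj
        rw [Finset.mem_insert, Finset.mem_singleton] at hj
        rcases hj with rfl | rfl
        · simp
        · simp [hi1]
      · intro j hj
        rw [Finset.mem_insert, Finset.mem_singleton, not_or, Fin.ext_iff, Fin.ext_iff, hi1] at hj
        refine div_pos ?_ (by positivity)
        rw [one_mul]
        rcases lt_or_gt_of_ne hj.1 with h | h
        · have h1 : (2 : ℝ) ^ (j : ℕ) < 2 ^ (i : ℕ) := pow_lt_pow_right₀ (by norm_num) h
          have h2 : (2 : ℝ) ^ (j : ℕ) < 2 ^ ((i : ℕ) + 1) :=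
            pow_lt_pow_right₀ (by norm_num) (by omega)
          exact mul_pos_of_neg_of_neg (by linarith) (by linarith)
        · have h1 : (2 : ℝ) ^ (i : ℕ) < 2 ^ (j : ℕ) := pow_lt_pow_right₀ (by norm_num) h
          have h2 : (2 : ℝ) ^ ((i : ℕ) + 1) < 2 ^ (j : ℕ) :=
            pow_lt_pow_right₀ (by norm_num) (by omega)
          exact mul_pos (by linarith) (by linarith)
  · rcases σ.eq_empty_or_nonempty with rfl | ⟨a, ha⟩
    · exact ⟨fun k => 1 * (2 ^ k - 0) * (2 ^ k - 0) / 2 ^ k, fun k => band_recurrence _ _ _ k,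
        by simp, fun i _ => by simp⟩
    · have hσa : ∀ j, j ∈ σ ↔ j = a := by
        refine fun j => ⟨fun hj => ?_, fun h => h ▸ ha⟩
        by_contra hne
        refine hσ2 (Finset.Subset.antisymm hi ?_)
        have h1 := hi ha
        have h2 := hi hj
        simp only [Finset.mem_insert, Finset.mem_singleton] at h1 h2
        rw [Finset.insert_subset_iff, Finset.singleton_subset_iff]
        rcases h1 with rfl | rfl <;> rcases h2 with rfl | rfl
        · exact absurd rfl hne
        · exact ⟨ha, hj⟩
        · exact ⟨hj, ha⟩
        · exact absurd rfl hne
      refine ⟨fun k => 1 * (2 ^ k - 2 ^ (a : ℕ)) * (2 ^ k - 2 ^ (a : ℕ)) / 2 ^ k,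
        fun k => band_recurrence _ _ _ k, fun j hj => by simp [(hσa j).1 hj], fun j hj => ?_⟩
      have : (2 : ℝ) ^ (j : ℕ) - 2 ^ (a : ℕ) ≠ 0 := by
        rw [sub_ne_zero]
        intro h
        exact hj ((hσa j).2 (Fin.ext (pow_right_injective₀ (by norm_num) (by norm_num) h)))
      refine div_pos ?_ (by positivity)
      rw [one_mul]
      exact mul_self_pos.2 this

theorem sum_mul_deformedMatrix {m : ℕ} (W : ℕ → ℝ) (j : Fin m) (hj : (j : ℕ) + 4 < m) :
    ∑ i : Fin m, W i * deformedMatrix m 0 i j =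
      2 * W (j + 1) - 7 * W (j + 2) + 7 * W (j + 3) - 2 * W (j + 4) := by
  have h : ∀ n, n < m → (∑ i : Fin m, if (i : ℕ) = n then W i else 0) = W n := fun n hn => by
    rw [Finset.sum_eq_single (⟨n, hn⟩ : Fin m)]
    · simp
    · intro i _ hi
      exact if_neg fun h => hi (Fin.ext h)
    · simp
  rw [← h (j + 1) (by omega), ← h (j + 2) (by omega), ← h (j + 3) (by omega),
    ← h (j + 4) (by omega), Finset.mul_sum, Finset.mul_sum, Finset.mul_sum, Finset.mul_sum,
    ← Finset.sum_sub_distrib, ← Finset.sum_add_distrib, ← Finset.sum_sub_distrib]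
  refine Finset.sum_congr rfl fun i _ => ?_
  simp only [deformedMatrix, Matrix.of_apply]
  split_ifs <;> first | omega | ring

/-- All rows of the band matrix except for two cyclically successive ones span: the recurrence runs
forward up to the omitted rows and backward down to them. -/
theorem eq_zero_of_bandRow_eq_zero {n : ℕ} {σ : Finset (Fin (n + 3))}
    (hσ : σ ∈ polygonComplex (n + 3)) {z : Fin (n + 3) → ℝ}
    (hz : ∀ j : Fin (n + 3), n + 3 ≤ (j : ℕ) + 4 → z j = 0)
    (h : ∀ i ∉ σ, bandRow (n + 3) i z = 0) : z = 0 := by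
  obtain ⟨a, ha⟩ := mem_polygonComplex_iff.1 hσ
  have hsmall : ∀ k, k < 4 → shiftPad z k = 0 := fun k hk => dif_neg (by omega)
  have hlarge : ∀ k, n + 3 ≤ k → shiftPad z k = 0 := fun k hk => by
    unfold shiftPad
    split_ifs with h'
    · exact hz _ (by simp only; omega)
    · rfl
  have hrel : ∀ k : ℕ, k ≠ a → k ≠ a + 1 → 2 * shiftPad z (k + 3) - 7 * shiftPad z (k + 2)
      + 7 * shiftPad z (k + 1) - 2 * shiftPad z k = 0 := by
    intro k h1 h2
    rcases Nat.eq_zero_or_pos k with rfl | hk0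
    · simp [hsmall]
    rcases lt_or_ge k (n + 3) with hk | hk
    · have hkσ : (⟨k, hk⟩ : Fin (n + 3)) ∉ σ := fun hmem => by
        have := ha hmem
        rw [Finset.mem_insert, Finset.mem_singleton, Fin.ext_iff, Fin.ext_iff] at this
        simp only at this
        rcases this with h | h
        · exact h1 h
        · by_cases hl : a = Fin.last (n + 2)
          · rw [hl, Fin.last_add_one] at h
            exact hk0.ne' h
          · rw [Fin.val_add_one_of_lt (Fin.lt_last_iff_ne_last.2 hl)] at h
            exact h2 h
      have := h _ hkσ
      rwa [bandRow_apply] at this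
    · simp [hlarge _ hk, hlarge (k + 1) (by omega), hlarge (k + 2) (by omega),
        hlarge (k + 3) (by omega)]
  have hforward : ∀ k, k < (a : ℕ) + 3 → shiftPad z k = 0 := by
    intro k
    induction k using Nat.strong_induction_on with
    | _ k ih =>
      intro hk
      rcases lt_or_ge k 4 with h4 | h4
      · exact hsmall k h4
      · obtain ⟨l, rfl⟩ := Nat.exists_eq_add_of_le' (show 3 ≤ k by omega)
        have := hrel l (by omega) (by omega)
        rw [ih (l + 2) (by omega) (by omega), ih (l + 1) (by omega) (by omega),
          ih l (by omega) (by omega)] at this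
        linarith
  have hbackward : ∀ d k, n + 3 ≤ k + d → (a : ℕ) + 2 ≤ k → shiftPad z k = 0 := by
    intro d
    induction d with
    | zero => exact fun k hk _ => hlarge k hk
    | succ d ih =>
      intro k hk hak
      have := hrel k (by omega) (by omega)
      rw [ih (k + 3) (by omega) (by omega), ih (k + 2) (by omega) (by omega),
        ih (k + 1) (by omega) (by omega)] at this
      linarith
  funext j
  have h1 : shiftPad z (j + 4) = z j := by
    unfold shiftPad
    rw [dif_pos ⟨by omega, by simp⟩]
    congr 1
  rw [Pi.zero_apply, ← h1]
  rcases lt_or_ge ((j : ℕ) + 4) (a + 3) with h | h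
  · exact hforward _ h
  · exact hbackward (n + 3) _ (by omega) (by omega)

/-- For small `ε`, the rows given by the fixed coordinates of a face of the quad-surface, truncated
to all but the last four coordinates, span and are positively dependent. -/
theorem eventually_exists_pos_weights {n : ℕ} {s : CubeFace (n + 3)}
    (hs : s ∈ quadSurface (n + 3)) :
    ∀ᶠ ε in nhds (0 : ℝ),
      (∃ w : Fin (n + 3) → ℝ, (∀ i, s i = none → w i = 0) ∧ (∀ i, s i ≠ none → 0 < w i) ∧
        ∀ z : Fin (n + 3) → ℝ, (∀ j : Fin (n + 3), n + 3 ≤ (j : ℕ) + 4 → z j = 0) →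
          ∑ i, w i * cubeRow (n + 3) ε ((s i).getD true) i z = 0) ∧
      ∀ z : Fin (n + 3) → ℝ, (∀ j : Fin (n + 3), n + 3 ≤ (j : ℕ) + 4 → z j = 0) →
        (∀ i β, s i = some β → cubeRow (n + 3) ε β i z = 0) → z = 0 := by
  obtain ⟨W, hrec, hW0, hWpos⟩ := exists_band_dependence hs
  let A : Matrix {i // s i ≠ none} {j : Fin (n + 3) // (j : ℕ) + 4 < n + 3} ℝ :=
    Matrix.of fun i j => deformedMatrix (n + 3) 0 i j
  let B : Matrix {i // s i ≠ none} {j : Fin (n + 3) // (j : ℕ) + 4 < n + 3} ℝ :=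
    Matrix.of fun i j => if (i : Fin (n + 3)) = j then boolSign ((s i).getD true) else 0
  have hmul : ∀ (ε : ℝ) (z : Fin (n + 3) → ℝ), (∀ j : Fin (n + 3), n + 3 ≤ (j : ℕ) + 4 → z j = 0) →
      ∀ i : {i // s i ≠ none}, (A + ε • B).mulVec (fun j => z j) i =
        cubeRow (n + 3) ε ((s i).getD true) i z := by
    intro ε z hz i
    rw [cubeRow_eq_mulVec, Matrix.mulVec, Matrix.mulVec, dotProduct, dotProduct,
      ← Finset.sum_subset (Finset.subset_univ
        (Finset.univ.filter fun j : Fin (n + 3) => (j : ℕ) + 4 < n + 3)),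
      ← Finset.sum_subtype_eq_sum_filter, Finset.subtype_univ]
    · refine Finset.sum_congr rfl fun j _ => ?_
      rw [deformedMatrix_eq_add]
      simp only [A, B, Matrix.add_apply, Matrix.smul_apply, Matrix.of_apply, smul_eq_mul, mul_ite,
        mul_zero]
      rw [add_comm, mul_comm ε]
    · intro j _ hj
      rw [Finset.mem_filter, not_and] at hj
      rw [hz j (not_lt.1 (hj (Finset.mem_univ j))), mul_zero]
  have hsum : ∀ f : Fin (n + 3) → ℝ, (∀ i, s i = none → f i = 0) →
      ∑ i : {i // s i ≠ none}, f i = ∑ i, f i := by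
    intro f hf
    rw [← Finset.sum_subset (Finset.subset_univ (Finset.univ.filter fun i => s i ≠ none)),
      ← Finset.sum_subtype_eq_sum_filter, Finset.subtype_univ]
    intro i _ hi
    rw [Finset.mem_filter, not_and, not_not] at hi
    exact hf i (hi (Finset.mem_univ i))
  have hA : ∀ z, A.mulVec z = 0 → z = 0 := by
    intro z hz
    let z' : Fin (n + 3) → ℝ := fun j => if h : (j : ℕ) + 4 < n + 3 then z ⟨j, h⟩ else 0
    have hzz : (fun j : {j : Fin (n + 3) // (j : ℕ) + 4 < n + 3} => z' j) = z :=
      funext fun j => dif_pos j.2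
    have hz'0 : ∀ j : Fin (n + 3), n + 3 ≤ (j : ℕ) + 4 → z' j = 0 := fun j hj =>
      dif_neg (not_lt.2 hj)
    have h0 : z' = 0 := by
      refine eq_zero_of_bandRow_eq_zero hs hz'0 fun i hi => ?_
      have h1 := hmul 0 z' hz'0 ⟨i, fun h => hi (CubeFace.mem_free.2 h)⟩
      rw [hzz, zero_smul, add_zero, hz, cubeRow_apply] at h1
      simpa using h1.symm
    rw [← hzz, h0]
    rfl
  have hwA : Matrix.vecMul (fun i : {i // s i ≠ none} => W (i : Fin (n + 3))) A = 0 := by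
    funext j
    have h1 := sum_mul_deformedMatrix W j.1 j.2
    rw [hrec] at h1
    refine (hsum (fun i => W i * deformedMatrix (n + 3) 0 i j.1) fun i hi => ?_).trans h1
    rw [hW0 i (CubeFace.mem_free.2 hi), zero_mul]
  filter_upwards [eventually_exists_pos_vecMul_eq_zero A B _
    (fun i => hWpos i fun h => i.2 (CubeFace.mem_free.1 h)) hwA hA] with ε hε
  obtain ⟨⟨w, hw, hwN⟩, hinj⟩ := hε
  constructor
  · refine ⟨fun i => if h : s i ≠ none then w ⟨i, h⟩ else 0, fun i hi => by simp [hi],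
      fun i hi => by simpa [hi] using hw ⟨i, hi⟩, fun z hz => ?_⟩
    rw [← hsum _ fun i hi => by simp [hi]]
    have h1 : dotProduct w ((A + ε • B).mulVec fun j => z j) = 0 := by
      rw [Matrix.dotProduct_mulVec, hwN, zero_dotProduct]
    refine Eq.trans (Finset.sum_congr rfl fun i _ => ?_) h1
    rw [hmul ε z hz]
    dsimp only
    rw [dif_pos i.2]
  · intro z hz hrow
    have h1 : (fun j : {j : Fin (n + 3) // (j : ℕ) + 4 < n + 3} => z j) = 0 := by
      refine hinj _ (funext fun i => ?_)
      obtain ⟨β, hβ⟩ := Option.ne_none_iff_exists'.1 i.2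
      rw [hmul ε z hz, hβ]
      exact hrow i β hβ
    funext j
    by_cases hj : (j : ℕ) + 4 < n + 3
    · exact congrFun h1 ⟨j, hj⟩
    · exact hz j (not_lt.1 hj)

/-! ### Central projection -/

section CentralProjection

variable {V : Type*} [AddCommGroup V] [Module ℝ V] {a : Module.Dual ℝ V} {c : ℝ} {y : V}

theorem map_schlegelProj (k : Module.Dual ℝ V) (x : V) :
    k (schlegelProj a c y x) = k y + (c - a y) / (a x - a y) * (k x - k y) := by
  simp [schlegelProj]

theorem schlegelProj_mem_hyperplane {x : V} (hx : a x < a y) : a (schlegelProj a c y x) = c := by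
  have : a x - a y ≠ 0 := by linarith [hx]
  rw [map_schlegelProj]
  field_simp
  ring

theorem schlegel_factor_pos (hy : c < a y) {x : V} (hx : a x < a y) :
    0 < (c - a y) / (a x - a y) :=
  div_pos_of_neg_of_neg (by linarith) (by linarith)

/-- Central projection acts on the weights of a convex combination by rescaling. -/
theorem schlegelProj_combination {u v : V} {p q A B : ℝ} (hA : a u - a y = A)
    (hB : a v - a y = B) (hpq : p + q = 1) (hA0 : A ≠ 0) (hB0 : B ≠ 0) (hC0 : p * A + q * B ≠ 0) :
    schlegelProj a c y (p • u + q • v) =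
      (p * A / (p * A + q * B)) • schlegelProj a c y u +
        (q * B / (p * A + q * B)) • schlegelProj a c y v := by
  have hC : a (p • u + q • v) - a y = p * A + q * B := by
    rw [map_add, map_smul, map_smul, smul_eq_mul, smul_eq_mul, ← hA, ← hB]
    linear_combination (a y) * hpq
  have hq : q = 1 - p := by linarith
  rw [schlegelProj, schlegelProj, schlegelProj, hA, hB, hC]
  subst hq
  match_scalars
  all_goals field_simp
  ring

theorem preservesSegments_schlegelProj :
    PreservesSegments {x | a x < a y} (schlegelProj a c y) := by
  intro u hu v hv
  have hu' : a u - a y < 0 := by have : a u < a y := hu; linarith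
  have hv' : a v - a y < 0 := by have : a v < a y := hv; linarith
  generalize hA : a u - a y = A at hu'
  generalize hB : a v - a y = B at hv'
  apply Set.Subset.antisymm
  · rintro _ ⟨_, ⟨p, q, hp, hq, hpq, rfl⟩, rfl⟩
    have h1 := mul_neg_of_pos_of_neg hp hu'
    have h2 := mul_neg_of_pos_of_neg hq hv'
    rw [schlegelProj_combination hA hB hpq hu'.ne hv'.ne (by linarith)]
    refine ⟨_, _, div_pos_of_neg_of_neg h1 (by linarith), div_pos_of_neg_of_neg h2 (by linarith),
      ?_, rfl⟩
    rw [← add_div, div_self (by linarith)]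
  · rintro _ ⟨p, q, hp, hq, hpq, rfl⟩
    have h1 := mul_neg_of_pos_of_neg hp hv'
    have h2 := mul_neg_of_pos_of_neg hq hu'
    have h3 : p * B + q * A ≠ 0 := by linarith
    have hAB : p * B / (p * B + q * A) * A + q * A / (p * B + q * A) * B =
        A * B / (p * B + q * A) := by
      rw [div_mul_eq_mul_div, div_mul_eq_mul_div, ← add_div]
      congr 1
      linear_combination A * B * hpq
    have hsum : p * B / (p * B + q * A) + q * A / (p * B + q * A) = 1 := by
      rw [← add_div, div_self h3]
    have hne : A * B / (p * B + q * A) ≠ 0 := div_ne_zero (mul_ne_zero hu'.ne hv'.ne) h3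
    refine ⟨(p * B / (p * B + q * A)) • u + (q * A / (p * B + q * A)) • v,
      ⟨_, _, div_pos_of_neg_of_neg h1 (by linarith), div_pos_of_neg_of_neg h2 (by linarith),
        hsum, rfl⟩, ?_⟩
    rw [schlegelProj_combination hA hB hsum hu'.ne hv'.ne (by rw [hAB]; exact hne), hAB]
    have hA0 := hu'.ne
    have hB0 := hv'.ne
    congr 2 <;> field_simp

theorem affineDim_schlegelProj_image_le [FiniteDimensional ℝ V] {S : Set V}
    (hS : ∀ x ∈ S, a x < a y) : affineDim (schlegelProj a c y '' S) ≤ affineDim S := by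
  rcases S.eq_empty_or_nonempty with rfl | ⟨x₀, hx₀⟩
  · simp
  -- The image lies in the intersection of the hyperplane and the cone from `y` over `S`.
  let U := vectorSpan ℝ S ⊔ Submodule.span ℝ {x₀ - y}
  have hxU : x₀ - y ∈ U := Submodule.mem_sup_right (Submodule.mem_span_singleton_self _)
  have hU : ∀ x ∈ S, schlegelProj a c y x - y ∈ U := by
    intro x hx
    have h1 : x - y ∈ U := by
      have := U.add_mem (Submodule.mem_sup_left (sub_mem_vectorSpan hx hx₀)) hxU
      rwa [sub_add_sub_cancel] at this
    rw [schlegelProj, add_sub_cancel_left]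
    exact U.smul_mem _ h1
  have hle : vectorSpan ℝ (schlegelProj a c y '' S) ≤ U ⊓ LinearMap.ker a := by
    refine le_inf ?_ (vectorSpan_le_ker (c := c) ?_)
    · rw [vectorSpan_def, Submodule.span_le]
      rintro _ ⟨_, ⟨u, hu, rfl⟩, _, ⟨v, hv, rfl⟩, rfl⟩
      have := U.sub_mem (hU u hu) (hU v hv)
      rwa [sub_sub_sub_cancel_right] at this
    · rintro _ ⟨u, hu, rfl⟩
      exact schlegelProj_mem_hyperplane (hS u hu)
  have hlt : U ⊓ LinearMap.ker a < U := by
    refine lt_of_le_of_ne inf_le_left fun h => ?_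
    rw [← h] at hxU
    have h1 := hxU.2
    rw [SetLike.mem_coe, LinearMap.mem_ker, map_sub, sub_eq_zero] at h1
    exact (hS x₀ hx₀).ne h1
  have h1 := Submodule.finrank_lt_finrank_of_lt hlt
  have h2 := Submodule.finrank_add_le_finrank_add_finrank (vectorSpan ℝ S)
    (Submodule.span ℝ {x₀ - y})
  have h3 := finrank_span_le_card (R := ℝ) {x₀ - y}
  simp only [Set.toFinset_singleton, Finset.card_singleton] at h3
  have h4 := Submodule.finrank_mono hle
  change Module.finrank ℝ (vectorSpan ℝ _) ≤ Module.finrank ℝ (vectorSpan ℝ S)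
  change Module.finrank ℝ U ≤ _ at h2
  omega

/-- Two points on a ray from `y` whose images coincide, the first of which lies on a supporting
hyperplane that strictly separates `y`: the first one is at least as far from `y`. -/
theorem schlegel_factor_le (hy : c < a y) {g : Module.Dual ℝ V} {d : ℝ} {v v' : V}
    (hv' : a v' < a y) (hgv : g v = d) (hgv' : g v' ≤ d) (hgy : g y < d)
    (h : schlegelProj a c y v = schlegelProj a c y v') :
    (c - a y) / (a v - a y) ≤ (c - a y) / (a v' - a y) := by
  have h1 := congrArg g h
  rw [map_schlegelProj, map_schlegelProj, add_right_inj, hgv] at h1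
  have h2 : (c - a y) / (a v' - a y) * (g v' - g y) ≤ (c - a y) / (a v' - a y) * (d - g y) :=
    mul_le_mul_of_nonneg_left (by linarith) (schlegel_factor_pos hy hv').le
  exact le_of_mul_le_mul_right (h1.trans_le h2) (by linarith)

theorem eq_of_schlegelProj_eq (hy : c < a y) {g g' : Module.Dual ℝ V} {d d' : ℝ} {v v' : V}
    (hv : a v < a y) (hv' : a v' < a y) (hgv : g v = d) (hgv' : g v' ≤ d) (hgy : g y < d)
    (hgv₁ : g' v' = d') (hgv₁' : g' v ≤ d') (hgy₁ : g' y < d')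
    (h : schlegelProj a c y v = schlegelProj a c y v') : v = v' := by
  have h1 := le_antisymm (schlegel_factor_le hy hv' hgv hgv' hgy h)
    (schlegel_factor_le hy hv hgv₁ hgv₁' hgy₁ h.symm)
  rw [schlegelProj, schlegelProj, add_right_inj, h1] at h
  have := smul_right_injective V (schlegel_factor_pos hy hv').ne' h
  exact sub_left_injective this

end CentralProjection

/-! ### Projections of the deformed cube -/

section Projection

variable {m : ℕ} {ε : ℝ} {b : Fin m → ℝ} {V E : Type*} [AddCommGroup V] [Module ℝ V]
  [AddCommGroup E] [Module ℝ E]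

/-- The face `s` of the deformed cube is strictly preserved by the projection `π`: its image is a
face of the projected polytope, only points of the face are mapped into this image, and `π` is
injective on the face. -/
def IsStrictlyPreserved (ε : ℝ) (b : Fin m → ℝ) (π : (Fin m → ℝ) →ₗ[ℝ] V) (s : CubeFace m) : Prop :=
  (∃ (h : Module.Dual ℝ V) (d : ℝ), IsValidOn (π '' deformedCube m ε b) h d ∧
    ∀ x ∈ deformedCube m ε b, h (π x) = d ↔ x ∈ deformedFace m ε b s) ∧
  Set.InjOn π (deformedFace m ε b s)

/-- The projection lemma: a face is strictly preserved if the normal vectors of the facets that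
contain it positively span, when they are restricted to the kernel of the projection. -/
theorem isStrictlyPreserved_of_weights {π : (Fin m → ℝ) →ₗ[ℝ] V} (hπ : Function.Surjective π)
    {s : CubeFace m} {w : Fin m → ℝ} (hw0 : ∀ i, s i = none → w i = 0)
    (hwpos : ∀ i, s i ≠ none → 0 < w i)
    (hker : ∀ z, π z = 0 → ∑ i, w i * cubeRow m ε ((s i).getD true) i z = 0)
    (hspan : ∀ z, π z = 0 → (∀ i β, s i = some β → cubeRow m ε β i z = 0) → z = 0) :
    IsStrictlyPreserved ε b π s := by
  constructor
  · obtain ⟨σ, hσ⟩ := π.exists_rightInverse_of_surjective (LinearMap.range_eq_top.2 hπ)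
    let f : Module.Dual ℝ (Fin m → ℝ) := ∑ i, w i • cubeRow m ε ((s i).getD true) i
    have hf : ∀ z, f z = ∑ i, w i * cubeRow m ε ((s i).getD true) i z := fun z => by
      simp [f, LinearMap.sum_apply]
    have hfπ : ∀ x, f (σ (π x)) = f x := fun x => by
      rw [← sub_eq_zero, ← map_sub, hf]
      refine hker _ ?_
      rw [map_sub, sub_eq_zero]
      exact LinearMap.congr_fun hσ (π x)
    have hle : ∀ x ∈ deformedCube m ε b, ∀ i ∈ Finset.univ,
        w i * cubeRow m ε ((s i).getD true) i x ≤ w i * b i := by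
      intro x hx i _
      by_cases hi : s i = none
      · rw [hw0 i hi, zero_mul, zero_mul]
      · exact mul_le_mul_of_nonneg_left (mem_deformedCube_iff.1 hx _ i) (hwpos i hi).le
    refine ⟨f.comp σ, ∑ i, w i * b i, ?_, fun x hx => ?_⟩
    · rintro _ ⟨x, hx, rfl⟩
      rw [LinearMap.comp_apply, hfπ, hf]
      exact Finset.sum_le_sum (hle x hx)
    · rw [LinearMap.comp_apply, hfπ, hf, Finset.sum_eq_sum_iff_of_le (hle x hx)]
      constructor
      · refine fun h => ⟨hx, fun i β hi => ?_⟩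
        have h1 := h i (Finset.mem_univ i)
        rw [hi, Option.getD_some] at h1
        exact mul_left_cancel₀ (hwpos i (by simp [hi])).ne' h1
      · intro h i _
        rcases hi : s i with _ | β
        · rw [hw0 i hi, zero_mul, zero_mul]
        · rw [Option.getD_some, h.2 i β hi]
  · intro x hx y hy hxy
    rw [← sub_eq_zero]
    refine hspan _ (by rw [map_sub, hxy, sub_self]) fun i β hi => ?_
    rw [map_sub, hx.2 i β hi, hy.2 i β hi, sub_self]

theorem IsStrictlyPreserved.eq_of_map_eq {π : (Fin m → ℝ) →ₗ[ℝ] V} {s : CubeFace m}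
    (hs : IsStrictlyPreserved ε b π s) {x y : Fin m → ℝ} (hx : x ∈ deformedFace m ε b s)
    (hy : y ∈ deformedCube m ε b) (h : π x = π y) : x = y := by
  obtain ⟨⟨k, d, -, hk⟩, hinj⟩ := hs
  exact hinj hx ((hk y hy).1 (h ▸ (hk x hx.1).2 hx)) h

theorem IsStrictlyPreserved.isFace {π : (Fin m → ℝ) →ₗ[ℝ] V} {s : CubeFace m}
    (hs : IsStrictlyPreserved ε b π s) :
    IsFace (π '' deformedCube m ε b) (π '' deformedFace m ε b s) := by
  obtain ⟨⟨k, d, hv, hk⟩, -⟩ := hs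
  refine ⟨k, d, hv, Set.Subset.antisymm ?_ ?_⟩
  · rintro _ ⟨x, hx, rfl⟩
    exact ⟨⟨x, hx.1, rfl⟩, (hk x hx.1).2 hx⟩
  · rintro _ ⟨⟨x, hx, rfl⟩, h⟩
    exact ⟨x, (hk x hx).1 h, rfl⟩

theorem isPolytope_projection (hε : 0 < ε) (hε' : ε ≤ 1 / 2) (hb : GrowsFast ε b)
    (π : (Fin m → ℝ) →ₗ[ℝ] V) : IsPolytope (π '' deformedCube m ε b) := by
  have h1 : deformedFace m ε b (fun _ => none) = deformedCube m ε b := by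
    simp [deformedFace]
  have h2 := isPolytope_deformedFace hε hε' hb fun _ => none
  rw [h1] at h2
  exact (π.toAffineMap.preservesSegments _).isPolytope_image h2

theorem affineDim_projection (hb : ∀ i, 0 < b i) {π : (Fin m → ℝ) →ₗ[ℝ] V}
    (hπ : Function.Surjective π) :
    affineDim (π '' deformedCube m ε b) = Module.finrank ℝ V := by
  have htop : vectorSpan ℝ (π '' deformedCube m ε b) = ⊤ := by
    rw [eq_top_iff]
    intro u _
    obtain ⟨v, rfl⟩ := hπ u
    have hev : ∀ᶠ δ in nhdsWithin (0 : ℝ) (Set.Ioi 0), ∀ β i, cubeRow m ε β i (δ • v) ≤ b i := by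
      rw [Filter.eventually_all]
      intro β
      rw [Filter.eventually_all]
      intro i
      have hc : Continuous fun δ : ℝ => cubeRow m ε β i (δ • v) := by
        simp only [map_smul, smul_eq_mul]
        fun_prop
      have hl := hc.tendsto 0
      simp only [zero_smul, map_zero] at hl
      filter_upwards [(hl.mono_left nhdsWithin_le_nhds).eventually_lt_const (hb i)] with δ hδ
      exact hδ.le
    obtain ⟨δ, h1, h2⟩ := (hev.and self_mem_nhdsWithin).exists
    have h0 : (0 : Fin m → ℝ) ∈ deformedCube m ε b :=
      mem_deformedCube_iff.2 fun β i => by rw [map_zero]; exact (hb i).le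
    have h3 := sub_mem_vectorSpan (Set.mem_image_of_mem π (mem_deformedCube_iff.2 h1))
      (Set.mem_image_of_mem π h0)
    rw [map_zero, sub_zero, map_smul] at h3
    exact (Submodule.smul_mem_iff _ (ne_of_gt h2)).1 h3
  rw [affineDim, htop, finrank_top]

variable [FiniteDimensional ℝ V] {Q : Set (CubeFace m)}

/-- Strictly preserved faces are realized in the boundary of the projected polytope. -/
theorem isGeometricRealization_projection (hε : 0 < ε) (hε' : ε ≤ 1 / 2) (hb : GrowsFast ε b)
    (hQ : ∀ s ∈ Q, ∀ t : CubeFace m, t.IsSubface s → t ∈ Q) {π : (Fin m → ℝ) →ₗ[ℝ] V}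
    (hπ : ∀ s ∈ Q, IsStrictlyPreserved ε b π s) :
    IsGeometricRealization Q fun s => π '' deformedFace m ε b s := by
  refine isGeometricRealization_image hε hε' hb hQ (π.toAffineMap.preservesSegments _)
    (fun s hs t _ x hx y hy h => (hπ s hs).eq_of_map_eq hx hy.1 h) (fun s _ t ht hts => ?_)
    fun s _ => (affineDim_image_le π.toAffineMap _).trans (affineDim_deformedFace_le hε s)
  obtain ⟨⟨k, d, hv, hk⟩, -⟩ := hπ t ht
  refine ⟨k, d, ?_, Set.Subset.antisymm ?_ ?_⟩
  · rintro _ ⟨x, hx, rfl⟩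
    exact hv _ ⟨x, hx.1, rfl⟩
  · rintro _ ⟨x, hx, rfl⟩
    exact ⟨⟨x, deformedFace_mono hts hx, rfl⟩, (hk x hx.1).2 hx⟩
  · rintro _ ⟨⟨x, hx, rfl⟩, h⟩
    exact ⟨x, (hk x hx.1).1 h, rfl⟩

/-- Strictly preserved faces remain realized after a central projection from a point `y`, provided
that each of them lies on a supporting hyperplane of the projected polytope that has `y` and the
polytope strictly on the same side. -/
theorem isGeometricRealization_schlegel [FiniteDimensional ℝ E] (hε : 0 < ε) (hε' : ε ≤ 1 / 2)
    (hb : GrowsFast ε b) (hQ : ∀ s ∈ Q, ∀ t : CubeFace m, t.IsSubface s → t ∈ Q)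
    {π : (Fin m → ℝ) →ₗ[ℝ] V} (hπ : ∀ s ∈ Q, IsStrictlyPreserved ε b π s)
    {a : Module.Dual ℝ V} {c : ℝ} {y : V} (hac : IsValidOn (π '' deformedCube m ε b) a c)
    (hy : c < a y)
    (hvis : ∀ s ∈ Q, ∃ (g : Module.Dual ℝ V) (d : ℝ), IsValidOn (π '' deformedCube m ε b) g d ∧
      (∀ x ∈ deformedFace m ε b s, g (π x) = d) ∧ g y < d)
    (ι : E →ᵃ[ℝ] V) (κ : V →ᵃ[ℝ] E) (hικ : ∀ v, a v = c → ι (κ v) = v) :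
    IsGeometricRealization Q
      fun s => (κ ∘ schlegelProj a c y ∘ π) '' deformedFace m ε b s := by
  have hlt : ∀ x ∈ deformedCube m ε b, a (π x) < a y := fun x hx =>
    (hac _ (Set.mem_image_of_mem π hx)).trans_lt hy
  have hseg : PreservesSegments (deformedCube m ε b) (κ ∘ schlegelProj a c y ∘ π) :=
    (κ.preservesSegments Set.univ).comp
      (preservesSegments_schlegelProj.comp (π.toAffineMap.preservesSegments _) hlt)
      (Set.mapsTo_univ _ _)
  have hικφ : ∀ x ∈ deformedCube m ε b,
      ι (κ (schlegelProj a c y (π x))) = schlegelProj a c y (π x) := fun x hx =>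
    hικ _ (schlegelProj_mem_hyperplane (hlt x hx))
  refine isGeometricRealization_image hε hε' hb hQ hseg ?_ ?_ ?_
  · intro s hs t ht x hx x' hx' h
    have h1 := congrArg ι h
    simp only [Function.comp_apply] at h1
    rw [hικφ x hx.1, hικφ x' hx'.1] at h1
    obtain ⟨g, d, hg, hgs, hgy⟩ := hvis s hs
    obtain ⟨g', d', hg', hgt, hgy'⟩ := hvis t ht
    exact (hπ s hs).eq_of_map_eq hx hx'.1 (eq_of_schlegelProj_eq hy (hlt x hx.1) (hlt x' hx'.1)
      (hgs x hx) (hg _ ⟨x', hx'.1, rfl⟩) hgy (hgt x' hx') (hg' _ ⟨x, hx.1, rfl⟩) hgy' h1)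
  · intro s hs t ht hts
    obtain ⟨g, d, -, hgs, hgy⟩ := hvis s hs
    obtain ⟨⟨h, d', hv, hh⟩, -⟩ := hπ t ht
    -- Subtract a multiple of the supporting functional `g` of the face `s` from the functional `h`
    -- that defines the face `t`, such that the resulting hyperplane passes through `y`.
    let τ := (d' - h y) / (d - g y)
    let k : Module.Dual ℝ V := h - τ • g
    have hky : k y = d' - τ * d := by
      have : d - g y ≠ 0 := by linarith
      simp only [k, τ, LinearMap.sub_apply, LinearMap.smul_apply, smul_eq_mul]
      field_simp
      ring
    have hkx : ∀ x ∈ deformedFace m ε b s,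
        k (schlegelProj a c y (π x)) =
          k y + (c - a y) / (a (π x) - a y) * (h (π x) - d') := by
      intro x hx
      rw [map_schlegelProj]
      congr 2
      rw [hky]
      simp only [k, LinearMap.sub_apply, LinearMap.smul_apply, smul_eq_mul, hgs x hx]
      ring
    have hlin : ∀ x ∈ deformedFace m ε b s,
        (k.comp ι.linear) (κ (schlegelProj a c y (π x))) =
          k y - k (ι 0) + (c - a y) / (a (π x) - a y) * (h (π x) - d') := by
      intro x hx
      have h1 := ι.linearMap_vsub (κ (schlegelProj a c y (π x))) 0
      rw [vsub_eq_sub, sub_zero, vsub_eq_sub, hικφ x hx.1] at h1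
      rw [LinearMap.comp_apply, h1, map_sub, hkx x hx]
      ring
    refine ⟨k.comp ι.linear, k y - k (ι 0), ?_, Set.Subset.antisymm ?_ ?_⟩
    · rintro _ ⟨x, hx, rfl⟩
      simp only [Function.comp_apply]
      rw [hlin x hx]
      have h1 := schlegel_factor_pos hy (hlt x hx.1)
      have h2 := hv _ ⟨x, hx.1, rfl⟩
      linarith [mul_nonneg h1.le (sub_nonneg.2 h2)]
    · rintro _ ⟨x, hx, rfl⟩
      refine ⟨⟨x, deformedFace_mono hts hx, rfl⟩, ?_⟩
      simp only [Function.comp_apply]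
      rw [hlin x (deformedFace_mono hts hx), (hh x hx.1).2 hx]
      ring
    · rintro _ ⟨⟨x, hx, rfl⟩, h1⟩
      refine ⟨x, (hh x hx.1).1 ?_, rfl⟩
      simp only [Function.comp_apply] at h1
      rw [hlin x hx, add_eq_left, mul_eq_zero, sub_eq_zero] at h1
      exact h1.resolve_left (schlegel_factor_pos hy (hlt x hx.1)).ne'
  · intro s hs
    rw [Set.image_comp, Set.image_comp]
    refine (affineDim_image_le κ _).trans ((affineDim_schlegelProj_image_le ?_).trans
      ((affineDim_image_le π.toAffineMap _).trans (affineDim_deformedFace_le hε s)))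
    rintro _ ⟨x, hx, rfl⟩
    exact hlt x hx.1

/-- In codimension two, strictly preserved faces are visible from all points beyond a facet: they
lie in some other facet. -/
theorem exists_isValidOn_lt_of_isBeyond (hε : 0 < ε) (hε' : ε ≤ 1 / 2) (hb : GrowsFast ε b)
    (hQ : ∀ s ∈ Q, ∀ t : CubeFace m, t.IsSubface s → t ∈ Q) {π : (Fin m → ℝ) →ₗ[ℝ] V}
    (hπ : Function.Surjective π) (hQπ : ∀ s ∈ Q, IsStrictlyPreserved ε b π s) {f : CubeFace m}
    (hf : f ∈ Q) (hdim : f.dim + 2 = Module.finrank ℝ V) {H₀ : Set V} {y : V}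
    (hy : IsBeyond (π '' deformedCube m ε b) H₀ y) :
    ∃ (g : Module.Dual ℝ V) (d : ℝ), IsValidOn (π '' deformedCube m ε b) g d ∧
      (∀ x ∈ deformedFace m ε b f, g (π x) = d) ∧ g y < d := by
  have hP := affineDim_projection (ε := ε) hb.1 hπ
  obtain ⟨k, d, hk, hkf, hfac, hne⟩ := exists_isFacet_ne (isPolytope_projection hε hε' hb π) hP
    (hQπ f hf).isFace ((nonempty_deformedFace hε hε' hb f).image π)
    (by rw [(isGeometricRealization_projection hε hε' hb hQ hQπ).dim_eq f hf, hP, hdim]) H₀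
  exact ⟨k, d, hk, fun x hx => hkf _ (Set.mem_image_of_mem π hx), hy.2 _ hfac hne k d hk rfl⟩

/-- A facet has a point in no strictly preserved face of smaller dimension; a point just above it
sees all these faces from the same side. -/
theorem exists_viewpoint (hε : 0 < ε) (hε' : ε ≤ 1 / 2) (hb : GrowsFast ε b)
    {π : (Fin m → ℝ) →ₗ[ℝ] V} (hQπ : ∀ s ∈ Q, IsStrictlyPreserved ε b π s)
    (hQd : ∀ s ∈ Q, s.dim + 2 ≤ affineDim (π '' deformedCube m ε b))
    {k : Module.Dual ℝ V} {d : ℝ}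
    (hfac : IsFacet (π '' deformedCube m ε b) (faceOf (π '' deformedCube m ε b) k d)) :
    k ≠ 0 ∧ ∃ y : V, d < k y ∧ ∀ s ∈ Q, ∃ (g : Module.Dual ℝ V) (d' : ℝ),
      IsValidOn (π '' deformedCube m ε b) g d' ∧
      (∀ x ∈ deformedFace m ε b s, g (π x) = d') ∧ g y < d' := by
  set P := π '' deformedCube m ε b with hPdef
  have hPc : Convex ℝ P := (isPolytope_projection hε hε' hb π).convex
  have hHc : Convex ℝ (faceOf P k d) := hfac.1.convex hPc
  obtain ⟨p₀, hp₀⟩ := hfac.2.1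
  have hk0 : k ≠ 0 := by
    rintro rfl
    have h1 : faceOf P 0 d = P := by
      ext x
      have : (0 : ℝ) = d := hp₀.2
      simp [faceOf, this]
    have := hfac.2.2
    rw [h1] at this
    omega
  refine ⟨hk0, ?_⟩
  choose! g d' hg hgs using fun s hs => (hQπ s hs).1
  -- A point of the facet outside of each face, and the average of these points.
  have hp : ∀ s : CubeFace m, ∃ p ∈ faceOf P k d, s ∈ Q → g s p < d' s := by
    intro s
    by_cases hs : s ∈ Q
    · obtain ⟨p, hp, hps⟩ : ∃ p ∈ faceOf P k d, p ∉ π '' deformedFace m ε b s := by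
        by_contra! hcon
        have h1 := affineDim_mono hcon
        have h2 := (affineDim_image_le π.toAffineMap _).trans
          (affineDim_deformedFace_le (b := b) hε s)
        have h3 := hQd s hs
        have h4 := hfac.2.2
        simp only [LinearMap.coe_toAffineMap] at h2
        omega
      obtain ⟨⟨x, hx, rfl⟩, hpk⟩ := hp
      refine ⟨π x, ⟨⟨x, hx, rfl⟩, hpk⟩, fun _ => lt_of_le_of_ne (hg s hs _ ⟨x, hx, rfl⟩) ?_⟩
      exact fun h => hps ⟨x, (hgs s hs x hx).1 h, rfl⟩
    · exact ⟨p₀, hp₀, fun h => absurd h hs⟩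
  choose p hpH hpg using hp
  let N : ℝ := Fintype.card (CubeFace m)
  have hN : 0 < N := Nat.cast_pos.2 Fintype.card_pos
  have hN1 : ∑ _s : CubeFace m, N⁻¹ = 1 := by
    rw [Finset.sum_const, Finset.card_univ, nsmul_eq_mul]
    exact mul_inv_cancel₀ hN.ne'
  let z := ∑ s : CubeFace m, N⁻¹ • p s
  have hz : z ∈ faceOf P k d :=
    hHc.sum_mem (fun _ _ => (inv_pos.2 hN).le) hN1 fun s _ => hpH s
  have hzg : ∀ s ∈ Q, g s z < d' s := by
    intro s hs
    have h1 : d' s = ∑ _t : CubeFace m, N⁻¹ * d' s := by rw [← Finset.sum_mul, hN1, one_mul]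
    rw [map_sum, h1]
    refine Finset.sum_lt_sum (fun t _ => ?_) ⟨s, Finset.mem_univ s, ?_⟩
    · rw [map_smul, smul_eq_mul]
      exact mul_le_mul_of_nonneg_left (hg s hs _ (hpH t).1) (inv_pos.2 hN).le
    · rw [map_smul, smul_eq_mul]
      exact mul_lt_mul_of_pos_left (hpg s hs) (inv_pos.2 hN)
  obtain ⟨u, hu⟩ : ∃ u, k u ≠ 0 := by
    by_contra! hcon
    exact hk0 (LinearMap.ext hcon)
  have hev : ∀ᶠ δ in nhdsWithin (0 : ℝ) (Set.Ioi 0),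
      ∀ s, s ∈ Q → g s (z + δ • (k u • u)) < d' s := by
    rw [Filter.eventually_all]
    intro s
    by_cases hs : s ∈ Q
    · have hc : Continuous fun δ : ℝ => g s (z + δ • (k u • u)) := by
        simp only [map_add, map_smul, smul_eq_mul]
        fun_prop
      have hl := hc.tendsto 0
      simp only [zero_smul, add_zero] at hl
      filter_upwards [(hl.mono_left nhdsWithin_le_nhds).eventually_lt_const (hzg s hs)] with δ hδ _
      exact hδ
    · exact Filter.Eventually.of_forall fun _ h => absurd h hs
  obtain ⟨δ, h1, h2⟩ := (hev.and self_mem_nhdsWithin).exists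
  refine ⟨z + δ • (k u • u), ?_, fun s hs =>
    ⟨g s, d' s, hg s hs, fun x hx => (hgs s hs x hx.1).2 hx, h1 s hs⟩⟩
  rw [map_add, hz.2, map_smul, map_smul, smul_eq_mul, smul_eq_mul]
  have : 0 < δ * (k u * k u) := mul_pos h2 (mul_self_pos.2 hu)
  linarith

end Projection

/-! ### The projection to the last four coordinates -/

theorem lastFour_surjective {m : ℕ} (hm : 4 ≤ m) : Function.Surjective (lastFour hm) :=
  LinearMap.funLeft_surjective_of_injective ℝ ℝ _ fun i j h => by
    have := congrArg Fin.val h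
    exact Fin.ext (by simp only at this; omega)

theorem eq_zero_of_lastFour_eq_zero {m : ℕ} (hm : 4 ≤ m) {z : Fin m → ℝ} (hz : lastFour hm z = 0)
    (j : Fin m) (hj : m ≤ (j : ℕ) + 4) : z j = 0 := by
  have hj' := j.2
  have h1 := congrFun hz ⟨j + 4 - m, by omega⟩
  have h2 : (⟨m - 4 + (j + 4 - m), by omega⟩ : Fin m) = j := Fin.ext (by simp only; omega)
  change z ⟨m - 4 + (j + 4 - m), _⟩ = 0 at h1
  rwa [h2] at h1

/-- For small `ε`, the projection to the last four coordinates strictly preserves all faces of the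
quad-surface. -/
theorem exists_forall_isStrictlyPreserved {n : ℕ} (hm : 4 ≤ n + 3) :
    ∃ ε₀ : ℝ, 0 < ε₀ ∧ ∀ ε : ℝ, 0 < ε → ε < ε₀ → ε ≤ 1 / 2 ∧
      ∀ b, ∀ s ∈ quadSurface (n + 3), IsStrictlyPreserved ε b (lastFour hm) s := by
  have h1 : ∀ᶠ ε in nhds (0 : ℝ), ∀ s : CubeFace (n + 3), s ∈ quadSurface (n + 3) → ∀ b,
      IsStrictlyPreserved ε b (lastFour hm) s := by
    rw [Filter.eventually_all]
    intro s
    by_cases hs : s ∈ quadSurface (n + 3)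
    · filter_upwards [eventually_exists_pos_weights hs] with ε hε _ b
      obtain ⟨⟨w, hw0, hwpos, hw⟩, hspan⟩ := hε
      exact isStrictlyPreserved_of_weights (lastFour_surjective hm) hw0 hwpos
        (fun z hz => hw z (eq_zero_of_lastFour_eq_zero hm hz))
        fun z hz => hspan z (eq_zero_of_lastFour_eq_zero hm hz)
    · exact Filter.Eventually.of_forall fun _ h => absurd h hs
  obtain ⟨δ, hδ, h2⟩ := Metric.eventually_nhds_iff.1 h1
  refine ⟨min δ (1 / 2), lt_min hδ (by norm_num), fun ε hε hlt =>
    ⟨(hlt.trans_le (min_le_right _ _)).le, fun b s hs => h2 ?_ s hs b⟩⟩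
  rw [Real.dist_eq, sub_zero, abs_of_pos hε]
  exact hlt.trans_le (min_le_left _ _)

theorem growsFast_pow (m : ℕ) {ε : ℝ} (hε : 0 < ε) :
    GrowsFast ε fun k : Fin m => (6 / ε) ^ (k : ℕ) :=
  ⟨fun k => by positivity, fun k l h => by simp only [h, pow_succ', le_refl]⟩

theorem AffineMap.exists_leftInverse_of_injective {V E : Type*} [AddCommGroup V] [Module ℝ V]
    [AddCommGroup E] [Module ℝ E] (ι : E →ᵃ[ℝ] V) (hι : Function.Injective ι) :
    ∃ κ : V →ᵃ[ℝ] E, ∀ w, κ (ι w) = w := by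
  obtain ⟨g, hg⟩ := ι.linear.exists_leftInverse_of_injective
    (LinearMap.ker_eq_bot.2 ((AffineMap.linear_injective_iff ι).2 hι))
  refine ⟨g.toAffineMap.comp (AffineMap.id ℝ V - AffineMap.const ℝ V (ι 0)), fun w => ?_⟩
  have h1 := ι.linearMap_vsub w 0
  rw [vsub_eq_sub, sub_zero, vsub_eq_sub] at h1
  change g (ι w - ι 0) = w
  rw [← h1]
  exact LinearMap.congr_fun hg w

/-- A hyperplane is affinely isomorphic to the space of one dimension less. -/
theorem exists_affineMap_range_eq_hyperplane {n : ℕ} {k : Module.Dual ℝ (Fin (n + 1) → ℝ)}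
    (hk : k ≠ 0) (d : ℝ) : ∃ ι : (Fin n → ℝ) →ᵃ[ℝ] (Fin (n + 1) → ℝ), Function.Injective ι ∧
      ∀ v, k v = d → v ∈ Set.range ι := by
  have hfin : Module.finrank ℝ (Fin n → ℝ) = Module.finrank ℝ (LinearMap.ker k) := by
    have := Module.Dual.finrank_ker_add_one_of_ne_zero hk
    simp only [Module.finrank_fin_fun] at this ⊢
    omega
  let e : (Fin n → ℝ) ≃ₗ[ℝ] LinearMap.ker k := LinearEquiv.ofFinrankEq _ _ hfin
  obtain ⟨u, hu⟩ : ∃ u, k u ≠ 0 := by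
    by_contra! hcon
    exact hk (LinearMap.ext hcon)
  let x₀ := (d / k u) • u
  have hx₀ : k x₀ = d := by
    simp only [x₀, map_smul, smul_eq_mul]
    field_simp
  refine ⟨((LinearMap.ker k).subtype.comp e.toLinearMap).toAffineMap +
    AffineMap.const ℝ _ x₀, fun x y h => ?_, fun v hv => ?_⟩
  · change (e x : Fin (n + 1) → ℝ) + x₀ = (e y : Fin (n + 1) → ℝ) + x₀ at h
    exact e.injective (Subtype.ext (add_right_cancel h))
  · have hmem : v - x₀ ∈ LinearMap.ker k := by
      rw [LinearMap.mem_ker, map_sub, hv, hx₀, sub_self]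
    refine ⟨e.symm ⟨v - x₀, hmem⟩, ?_⟩
    change (e (e.symm ⟨v - x₀, hmem⟩) : Fin (n + 1) → ℝ) + x₀ = v
    rw [e.apply_symm_apply, sub_add_cancel]

/-- The affine span of a facet of a full-dimensional polytope is the supporting hyperplane. -/
theorem mem_affineSpan_of_isFacet {V : Type*} [AddCommGroup V] [Module ℝ V]
    [FiniteDimensional ℝ V] {P : Set V} (hP : affineDim P = Module.finrank ℝ V)
    {a : Module.Dual ℝ V} {c : ℝ} (ha : a ≠ 0) (hF : IsFacet P (faceOf P a c)) {v : V}
    (hv : a v = c) : v ∈ affineSpan ℝ (faceOf P a c) := by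
  obtain ⟨x, hx⟩ := hF.2.1
  have hfin : Module.finrank ℝ (vectorSpan ℝ (faceOf P a c)) =
      Module.finrank ℝ (LinearMap.ker a) := by
    have h1 := Module.Dual.finrank_ker_add_one_of_ne_zero ha
    have h2 := hF.2.2
    rw [hP] at h2
    change affineDim _ = _
    omega
  have heq : vectorSpan ℝ (faceOf P a c) = LinearMap.ker a :=
    Submodule.eq_of_le_of_finrank_eq (vectorSpan_le_ker fun x hx => hx.2) hfin
  have hmem : v - x ∈ vectorSpan ℝ (faceOf P a c) := by
    rw [heq, LinearMap.mem_ker, map_sub, hv, hx.2, sub_self]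
  have := AffineSubspace.vadd_mem_of_mem_direction
    ((direction_affineSpan ℝ (faceOf P a c)).symm ▸ hmem) (subset_affineSpan ℝ _ hx)
  rwa [vadd_eq_add, sub_add_cancel] at this

/-! ### The realizations -/

theorem exists_realization_three : ∃ R : CubeFace 3 → Set (Fin 3 → ℝ),
    IsGeometricRealization (quadSurface 3) R := by
  have hε : (0 : ℝ) < 1 / 2 := by norm_num
  -- The quad-surface of a triangle is the boundary of the 3-cube itself.
  refine ⟨_, isGeometricRealization_projection hε le_rfl (growsFast_pow 3 hε)
    (fun s hs t => quadSurface_of_subface hs) (π := LinearMap.id) fun s _ =>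
      isStrictlyPreserved_of_weights Function.surjective_id
        (w := fun i => if s i = none then 0 else 1) (fun i hi => if_pos hi)
        (fun i hi => by simp [hi]) (fun z hz => ?_) fun z hz _ => hz⟩
  rw [LinearMap.id_apply] at hz
  simp [hz]

theorem exists_realization {n : ℕ} (hm : 4 ≤ n + 3) :
    ∃ R : CubeFace (n + 3) → Set (Fin 3 → ℝ),
      IsGeometricRealization (quadSurface (n + 3)) R := by
  obtain ⟨ε₀, hε₀, h⟩ := exists_forall_isStrictlyPreserved hm
  have hε : 0 < ε₀ / 2 := by positivity
  obtain ⟨hε', hpres⟩ := h (ε₀ / 2) hε (by linarith)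
  have hb := growsFast_pow (n + 3) hε
  have hpres := hpres fun k : Fin (n + 3) => (6 / (ε₀ / 2)) ^ (k : ℕ)
  generalize (fun k : Fin (n + 3) => (6 / (ε₀ / 2)) ^ (k : ℕ)) = b at hb hpres
  have hQ : ∀ s ∈ quadSurface (n + 3), ∀ t : CubeFace (n + 3), t.IsSubface s →
      t ∈ quadSurface (n + 3) := fun s hs t => quadSurface_of_subface hs
  have hP : affineDim (lastFour hm '' deformedCube (n + 3) (ε₀ / 2) b) = 4 :=
    (affineDim_projection hb.1 (lastFour_surjective hm)).trans (by simp)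
  obtain ⟨f, hf, hfd, -⟩ := exists_dim_two_of_mem_quadSurface
    (quadSurface_of_dim_zero (v := fun _ : Fin (n + 3) => some true)
      (CubeFace.dim_eq_zero.2 fun i => by simp))
  obtain ⟨k, d, hk, -, hfac, -⟩ := exists_isFacet_ne (isPolytope_projection hε hε' hb _)
    (hP.trans (by simp)) (hpres f hf).isFace ((nonempty_deformedFace hε hε' hb f).image _)
    (by rw [(isGeometricRealization_projection hε hε' hb hQ hpres).dim_eq f hf, hP, hfd]) ∅
  obtain ⟨hk0, y, hy, hvis⟩ := exists_viewpoint hε hε' hb hpres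
    (fun s hs => by rw [hP]; have := hs.1; change s.free.card + 2 ≤ 4; omega) hfac
  obtain ⟨ι, hι, hrange⟩ := exists_affineMap_range_eq_hyperplane hk0 d
  obtain ⟨κ, hκ⟩ := ι.exists_leftInverse_of_injective hι
  refine ⟨_, isGeometricRealization_schlegel hε hε' hb hQ hpres hk hy hvis ι κ fun v hv => ?_⟩
  obtain ⟨w, rfl⟩ := hrange v hv
  rw [hκ]

theorem exists_realization_in_schlegelDiagram {n : ℕ} (hm : 4 ≤ n + 3) {ε : ℝ} (hε : 0 < ε)
    (hε' : ε ≤ 1 / 2) {b : Fin (n + 3) → ℝ} (hb : GrowsFast ε b)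
    (hpres : ∀ s ∈ quadSurface (n + 3), IsStrictlyPreserved ε b (lastFour hm) s)
    {a : Module.Dual ℝ (Fin 4 → ℝ)} {c : ℝ} (hac : IsValidOn (projectedCube hm ε b) a c)
    (hfac : IsFacet (projectedCube hm ε b) (faceOf (projectedCube hm ε b) a c)) {y : Fin 4 → ℝ}
    (hy : IsBeyond (projectedCube hm ε b) (faceOf (projectedCube hm ε b) a c) y)
    {ι : (Fin 3 → ℝ) →ᵃ[ℝ] (Fin 4 → ℝ)} (hι : Function.Injective ι)
    (hrange : Set.range ι =
      (affineSpan ℝ (faceOf (projectedCube hm ε b) a c) : Set (Fin 4 → ℝ))) :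
    ∃ R : CubeFace (n + 3) → Set (Fin 3 → ℝ), IsGeometricRealization (quadSurface (n + 3)) R ∧
      ∀ s ∈ quadSurface (n + 3),
        ι '' R s ∈ schlegelDiagram (projectedCube hm ε b) a c y := by
  have hQ : ∀ s ∈ quadSurface (n + 3), ∀ t : CubeFace (n + 3), t.IsSubface s →
      t ∈ quadSurface (n + 3) := fun s hs t => quadSurface_of_subface hs
  have hP : affineDim (projectedCube hm ε b) = 4 :=
    (affineDim_projection hb.1 (lastFour_surjective hm)).trans (by simp)
  have hd : ∀ s ∈ quadSurface (n + 3), affineDim (lastFour hm '' deformedFace (n + 3) ε b s) ≤ 2 :=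
    fun s hs => ((isGeometricRealization_projection hε hε' hb hQ hpres).dim_eq s hs).trans_le hs.1
  have hya : c < a y := hy.1 a c hac rfl
  have ha : a ≠ 0 := by
    rintro rfl
    obtain ⟨p, -, hp⟩ := hfac.2.1
    exact hya.ne' hp
  obtain ⟨κ, hκ⟩ := ι.exists_leftInverse_of_injective hι
  have hικ : ∀ v, a v = c → ι (κ v) = v := by
    intro v hv
    have : v ∈ Set.range ι := by
      rw [hrange]
      exact mem_affineSpan_of_isFacet (hP.trans (by simp)) ha hfac hv
    obtain ⟨w, rfl⟩ := this
    rw [hκ]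
  refine ⟨_, isGeometricRealization_schlegel hε hε' hb hQ hpres hac hya ?_ ι κ hικ,
    fun s hs => ⟨lastFour hm '' deformedFace (n + 3) ε b s, (hpres s hs).isFace, ?_, ?_, ?_⟩⟩
  · intro s hs
    obtain ⟨f, hf, hfd, hsf⟩ := exists_dim_two_of_mem_quadSurface hs
    obtain ⟨g, d, hg, hgf, hgy⟩ := exists_isValidOn_lt_of_isBeyond hε hε' hb hQ
      (lastFour_surjective hm) hpres hf (by rw [hfd]; simp) hy
    exact ⟨g, d, hg, fun x hx => hgf x (deformedFace_mono hsf hx), hgy⟩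
  · intro h
    have := hd s hs
    rw [h, hP] at this
    omega
  · intro h
    have h1 := hd s hs
    have h2 := hfac.2.2
    rw [h] at h1
    omega
  · rw [Set.image_image, Set.image_image]
    refine Set.image_congr fun x hx => hικ _ (schlegelProj_mem_hyperplane ?_)
    exact (hac _ ⟨x, hx.1, rfl⟩).trans_lt hya

theorem mainTheorem1 (m : ℕ) (hm : 3 ≤ m) :
    -- the combinatorial surface
    IsCombinatorialSurface (quadSurface m) ∧
    numFaces (quadSurface m) 0 = 2 ^ m ∧
    numFaces (quadSurface m) 1 = m * 2 ^ (m - 1) ∧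
    numFaces (quadSurface m) 2 = m * 2 ^ (m - 2) ∧
    genus (quadSurface m) = 1 + ((m : ℚ) - 4) * 2 ^ (m - 3) ∧
    -- the realization in 3-space
    (∃ R : CubeFace m → Set (Fin 3 → ℝ), IsGeometricRealization (quadSurface m) R) ∧
    -- the realization as a subcomplex of the Schlegel diagram; the map `ι` identifies 3-space with
    -- the hyperplane of the facet at which the diagram is based
    (∀ hm4 : 4 ≤ m, ∃ ε₀ : ℝ, 0 < ε₀ ∧ ∀ ε : ℝ, 0 < ε → ε < ε₀ →
      ∀ b : Fin m → ℝ, GrowsFast ε b →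
        IsPolytope (projectedCube hm4 ε b) ∧ affineDim (projectedCube hm4 ε b) = 4 ∧
        ∀ (a : Module.Dual ℝ (Fin 4 → ℝ)) (c : ℝ), IsValidOn (projectedCube hm4 ε b) a c →
          IsFacet (projectedCube hm4 ε b) (faceOf (projectedCube hm4 ε b) a c) →
          ∀ y : Fin 4 → ℝ,
            IsBeyond (projectedCube hm4 ε b) (faceOf (projectedCube hm4 ε b) a c) y →
            ∀ ι : (Fin 3 → ℝ) →ᵃ[ℝ] (Fin 4 → ℝ), Function.Injective ι →
              Set.range ι = (affineSpan ℝ (faceOf (projectedCube hm4 ε b) a c) :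
                Set (Fin 4 → ℝ)) →
              ∃ R : CubeFace m → Set (Fin 3 → ℝ),
                IsGeometricRealization (quadSurface m) R ∧
                ∀ s ∈ quadSurface m,
                  ι '' R s ∈ schlegelDiagram (projectedCube hm4 ε b) a c y) := by

  obtain ⟨n, rfl⟩ := Nat.exists_eq_add_of_le' hm
  refine ⟨quadSurface_isCombinatorialSurface n, numFaces_quadSurface_zero n,
    numFaces_quadSurface_one n, numFaces_quadSurface_two n, genus_quadSurface n, ?_, ?_⟩
  · rcases n.eq_zero_or_pos with rfl | hn
    · exact exists_realization_three
    · exact exists_realization (by omega)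
  · intro hm4
    obtain ⟨ε₀, hε₀, h⟩ := exists_forall_isStrictlyPreserved hm4
    refine ⟨ε₀, hε₀, fun ε hε hlt b hb => ?_⟩
    obtain ⟨hε', hpres⟩ := h ε hε hlt
    exact ⟨isPolytope_projection hε hε' hb _,
      (affineDim_projection hb.1 (lastFour_surjective hm4)).trans (by simp),
      fun a c hac hfac y hy ι hι hrange =>
        exists_realization_in_schlegelDiagram hm4 hε hε' hb (hpres b) hac hfac hy hι hrange⟩
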